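/- Let $(X_i)_{i\in\mathbb Z}$ be a strictly stationary sequence of real-valued random variables on a probability space $(\Omega,\mathcal A,\mathbb P)$. Let $\mu$ be the law of $X_0$, let $\mu_n=\frac1n\sum_{k=1}^n\delta_{X_k}$ be the empirical measure, and let $H(t)=\mathbb P(|X_0|>t)$. For $k\ge 0$ let $$\alpha(k)=\sup\big\{|\mathbb P(A\cap B)-\mathbb P(A)\mathbb P(B)| : A\in\sigma(X_i,\ i\le 0),\ B\in\sigma(X_i,\ i\ge k)\big\}$$ be the strong mixing coefficients. Let $W_1(\nu,\nu')=\inf_\pi\int|x-y|\,\pi(dx,dy)$ be the Kantorovich distance between probability measures $\nu$, $\nu'$ on $\mathbb R$, the infimum being over all probability measures $\pi$ on $\mathbb R^2$ with marginals $\nu$ and $\nu'$. Put $$V=\int_0^\infty\sqrt{\sum_{k=0}^\infty\big(\alpha(k)\wedge H(t)\big)}\;dt .$$ There is a universal constant $\eta>0$ (depending neither on the probability space nor on the sequence) such that, whenever $V<\infty$, for every $\varepsilon>0$ $$\sum_{n\ge 3}\frac1n\,\mathbb P\Big(\max_{1\le k\le n}k\,W_1(\mu_k,\mu)>(\eta V+\varepsilon)\sqrt{n\log\log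 n}\Big)<\infty .$$ -/

import Mathlib

open MeasureTheory
open scoped ENNReal

universe u

noncomputable section

namespace MixingLIL

variable {Ω : Type u} [MeasurableSpace Ω]

/-- Strict stationarity: the law of the whole sequence on `ℤ → ℝ` is invariant under all shifts. -/
def StrictlyStationary (X : ℤ → Ω → ℝ) (P : Measure Ω) : Prop :=
  ∀ h : ℤ, P.map (fun ω (i : ℤ) => X (i + h) ω) = P.map (fun ω (i : ℤ) => X i ω)

/-- The past σ-algebra `σ(X_i, i ≤ 0)`. -/
def past {Ω : Type u} (X : ℤ → Ω → ℝ) : MeasurableSpace Ω :=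
  ⨆ i : ℤ, ⨆ _ : i ≤ 0, MeasurableSpace.comap (X i) inferInstance

/-- The future σ-algebra `σ(X_i, i ≥ k)`. -/
def future {Ω : Type u} (X : ℤ → Ω → ℝ) (k : ℕ) : MeasurableSpace Ω :=
  ⨆ i : ℤ, ⨆ _ : (k : ℤ) ≤ i, MeasurableSpace.comap (X i) inferInstance

/-- The strong mixing coefficient `α(k)` of Rosenblatt
(for a probability measure, a supremum of a non-empty set of reals bounded by `1`). -/
def alpha (X : ℤ → Ω → ℝ) (P : Measure Ω) (k : ℕ) : ℝ :=
  sSup {r : ℝ | ∃ A B : Set Ω, MeasurableSet[past X] A ∧ MeasurableSet[future X k] B ∧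
    r = |P.real (A ∩ B) - P.real A * P.real B|}

/-- The tail function `H(t) = P(|X_0| > t)`. -/
def tail (X : ℤ → Ω → ℝ) (P : Measure Ω) (t : ℝ) : ℝ :=
  P.real {ω | t < |X 0 ω|}

/-- `V = ∫_0^∞ √(∑_{k ≥ 0} α(k) ∧ H(t)) dt`, with values in `[0, ∞]`. -/
def V (X : ℤ → Ω → ℝ) (P : Measure Ω) : ℝ≥0∞ :=
  ∫⁻ t in Set.Ioi (0 : ℝ),
    (∑' k : ℕ, ENNReal.ofReal (min (alpha X P k) (tail X P t))) ^ (1 / 2 : ℝ)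

/-- The Kantorovich distance: the infimum of `∫ |x - y| dπ` over all couplings `π`,
with values in `[0, ∞]`. -/
def W1 (μ ν : Measure ℝ) : ℝ≥0∞ :=
  ⨅ (π : Measure (ℝ × ℝ)) (_ : IsProbabilityMeasure π ∧ π.fst = μ ∧ π.snd = ν),
    ∫⁻ z, ENNReal.ofReal |z.1 - z.2| ∂π

/-- The empirical measure `(1/n) ∑_{k=1}^n δ_{X_k}` (used for `n ≥ 1`). -/
def empirical {Ω : Type u} (X : ℤ → Ω → ℝ) (n : ℕ) (ω : Ω) : Measure ℝ :=
  (n : ℝ≥0∞)⁻¹ • ∑ k ∈ Finset.Icc 1 n, Measure.dirac (X (k : ℤ) ω)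

/-- `max_{1 ≤ k ≤ n} k W_1(μ_k, μ)`, where `μ` is the law of `X_0`. -/
def maxW1 (X : ℤ → Ω → ℝ) (P : Measure Ω) (n : ℕ) (ω : Ω) : ℝ≥0∞ :=
  ⨆ k ∈ Finset.Icc 1 n, (k : ℝ≥0∞) * W1 (empirical X k ω) (P.map (X 0))

end MixingLIL

end

/-! On the line, `W1` is at most the `L¹` distance of the distribution functions (quantile coupling,
`W1_le_lintegral`). Hence the maximum of `k W_1(μ_k, μ)` is at most the integral over levels `t` of
`maxDev`, the maximal centred indicator sum at level `t`. It suffices to control each level with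
bounds proportional to `σ(t) = √(∑_k α(k) ∧ H(|t|))`, since `∫ σ = 2V` over the whole line.

At a fixed level put `x = √(n / log log n)` and cut the sum into blocks of length `q = ⌊σ x⌋`, a
length that depends on the level. Blocks of even and of odd rank are treated separately, so that
consecutive blocks of one family are separated by `q` indices. The block sums divided by `q` are
bounded by `1`. Subtracting the conditional compensators `E(exp U - 1 | past)` makes the exponential
of the sums a supermartingale, and the potential `m + exp(z - m)`, with `m` the running maximum
started at `p`, gives `E m ≤ p + exp(-p)` (`integral_runMax_compSum_le`). Each compensator is within
`8 (α(q) ∧ h)` of its mean in `L¹` by mixing, and that mean is at most `2σ²/q` by the variance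
bound. With `p = 2 log log n`, the deviation is at most `13 σ √(n log log n)` plus a remainder of
mean at most `4 σ x (log n)⁻² + 32 n (α(q) ∧ h)` (`MomentBounds.exists_remainder_abs_sum`).

Weighted by `1 / (n √(n log log n))`, these means sum over `n` to at most a constant times `σ`: the
first part because `∑ 1/(n log² n)` converges; the second because `1/√(n log log n)` is comparable
to an increment of `x`, so that the sum is dominated by `∫ (α(⌊σ y⌋) ∧ h) dy = σ⁻¹ σ²`
(`tsum_remainder_le`). Integrating over `t` and applying Markov's inequality to the integrated
excess finishes the proof, with `η = 2 · 13`. -/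

namespace MixingLIL

/-! ### Quantile coupling and the Kantorovich distance on the line. -/

/-- The quantile function of a measure on the line. -/
noncomputable def quantile (μ : Measure ℝ) (u : ℝ) : ℝ := sInf {x | u ≤ ProbabilityTheory.cdf μ x}

/-- Right-continuity of the distribution function makes the infimum attained. The endpoints are
excluded because there the set may be empty or unbounded below, where `sInf` takes a default value.
-/
lemma quantile_le_iff (μ : Measure ℝ) {u t : ℝ} (hu : u ∈ Set.Ioo (0 : ℝ) 1) :
    quantile μ u ≤ t ↔ u ≤ ProbabilityTheory.cdf μ t := by
  set F := ProbabilityTheory.cdf μ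
  have hne : {x | u ≤ F x}.Nonempty := by
    have := (ProbabilityTheory.tendsto_cdf_atTop μ).eventually (eventually_ge_nhds hu.2)
    exact this.exists
  have hbd : BddBelow {x | u ≤ F x} := by
    obtain ⟨y, hy⟩ :=
      ((ProbabilityTheory.tendsto_cdf_atBot μ).eventually (eventually_lt_nhds hu.1)).exists
    refine ⟨y, fun x hx => ?_⟩
    by_contra hlt
    have h1 : F x ≤ F y := F.mono (not_le.1 hlt).le
    exact absurd (lt_of_le_of_lt (le_trans hx h1) hy) (lt_irrefl _)
  constructor
  · intro h
    have hr := (F.right_continuous t).mono_left (nhdsWithin_mono t Set.Ioi_subset_Ici_self)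
    refine ge_of_tendsto hr ?_
    filter_upwards [self_mem_nhdsWithin] with y hy
    obtain ⟨x, hx, hxy⟩ := exists_lt_of_csInf_lt hne (lt_of_le_of_lt h hy)
    exact le_trans hx (F.mono hxy.le)
  · intro h
    exact csInf_le hbd h

lemma monotoneOn_quantile (μ : Measure ℝ) : MonotoneOn (quantile μ) (Set.Ioo 0 1) := by
  intro u hu v hv huv
  rw [quantile_le_iff μ hu]
  exact huv.trans ((quantile_le_iff μ hv).1 le_rfl)

lemma aemeasurable_quantile (μ : Measure ℝ) :
    AEMeasurable (quantile μ) (volume.restrict (Set.Ioo (0 : ℝ) 1)) :=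
  aemeasurable_restrict_of_monotoneOn measurableSet_Ioo (monotoneOn_quantile μ)

lemma map_quantile (μ : Measure ℝ) [IsProbabilityMeasure μ] :
    (volume.restrict (Set.Ioo (0 : ℝ) 1)).map (quantile μ) = μ := by
  refine Measure.ext_of_Iic _ _ fun t => ?_
  rw [Measure.map_apply_of_aemeasurable (aemeasurable_quantile μ) measurableSet_Iic,
    Measure.restrict_apply' measurableSet_Ioo]
  set F := ProbabilityTheory.cdf μ with hF
  have h0 : 0 ≤ F t := ProbabilityTheory.cdf_nonneg μ t
  have h1 : F t ≤ 1 := ProbabilityTheory.cdf_le_one μ t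
  have h2 : quantile μ ⁻¹' Set.Iic t ∩ Set.Ioo 0 1 = Set.Iic (F t) ∩ Set.Ioo 0 1 := by
    ext u
    simp only [Set.mem_inter_iff, Set.mem_preimage, Set.mem_Iic]
    exact and_congr_left fun hu => quantile_le_iff μ hu
  rw [h2, ← ProbabilityTheory.ofReal_cdf μ t]
  apply le_antisymm
  · calc volume (Set.Iic (F t) ∩ Set.Ioo 0 1) ≤ volume (Set.Icc 0 (F t)) :=
        measure_mono fun u hu => ⟨hu.2.1.le, hu.1⟩
      _ = _ := by rw [Real.volume_Icc, sub_zero]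
  · calc ENNReal.ofReal (F t) = volume (Set.Ioo 0 (F t)) := by rw [Real.volume_Ioo, sub_zero]
      _ ≤ _ := by
        refine measure_mono fun u hu => ?_
        exact ⟨hu.2.le, hu.1, hu.2.trans_le h1⟩

/-- The Kantorovich distance on the line is at most the `L¹` distance of distribution functions. -/
lemma W1_le_lintegral (μ ν : Measure ℝ) [IsProbabilityMeasure μ] [IsProbabilityMeasure ν] :
    W1 μ ν ≤ ∫⁻ t, ENNReal.ofReal |μ.real (Set.Iic t) - ν.real (Set.Iic t)| := by
  set lam := (volume : Measure ℝ).restrict (Set.Ioo (0 : ℝ) 1) with hlam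
  set F := ProbabilityTheory.cdf μ with hF
  set G := ProbabilityTheory.cdf ν with hG
  have hμ := aemeasurable_quantile μ
  have hν := aemeasurable_quantile ν
  have : IsProbabilityMeasure lam := ⟨by simp [hlam]⟩
  set π := lam.map (fun u => (quantile μ u, quantile ν u)) with hπ
  have hπp : IsProbabilityMeasure π := Measure.isProbabilityMeasure_map (hμ.prodMk hν)
  have h1 : π.fst = μ := by
    rw [Measure.fst, hπ, AEMeasurable.map_map_of_aemeasurable measurable_fst.aemeasurable
      (hμ.prodMk hν)]
    exact map_quantile μ
  have h2 : π.snd = ν := by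
    rw [Measure.snd, hπ, AEMeasurable.map_map_of_aemeasurable measurable_snd.aemeasurable
      (hμ.prodMk hν)]
    exact map_quantile ν
  refine (iInf₂_le π ⟨hπp, h1, h2⟩).trans ?_
  rw [hπ, lintegral_map' (by fun_prop) (hμ.prodMk hν)]
  -- The region between the two graphs. Its section at height `u` has length the distance of the
  -- quantiles, and its section at abscissa `t` has length the distance of the distribution
  -- functions, so Tonelli compares the two integrals.
  set S : Set (ℝ × ℝ) := {z | min (F z.2) (G z.2) < z.1 ∧ z.1 ≤ max (F z.2) (G z.2)} with hS
  have hFm : Measurable F := F.mono.measurable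
  have hGm : Measurable G := G.mono.measurable
  have hSm : MeasurableSet S := by
    refine (measurableSet_lt (f := fun z : ℝ × ℝ => min (F z.2) (G z.2)) (g := Prod.fst)
      ?_ ?_).inter (measurableSet_le (f := Prod.fst) (g := fun z : ℝ × ℝ => max (F z.2) (G z.2))
      ?_ ?_) <;> fun_prop
  have key : ∀ u ∈ Set.Ioo (0 : ℝ) 1, ENNReal.ofReal |quantile μ u - quantile ν u| =
      ∫⁻ t, S.indicator 1 (u, t) := by
    intro u hu
    have e : (fun t => S.indicator (1 : ℝ × ℝ → ℝ≥0∞) (u, t)) =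
        (Set.Ico (min (quantile μ u) (quantile ν u)) (max (quantile μ u) (quantile ν u))).indicator
          1 := by
      ext t
      have hiff : (u, t) ∈ S ↔ t ∈ Set.Ico (min (quantile μ u) (quantile ν u))
          (max (quantile μ u) (quantile ν u)) := by
        simp only [hS, Set.mem_ofPred_eq, Set.mem_Ico, ← not_le, le_min_iff, max_le_iff, le_max_iff,
          min_le_iff, quantile_le_iff μ hu, quantile_le_iff ν hu, ← hF, ← hG]
        tauto
      by_cases h : (u, t) ∈ S
      · rw [Set.indicator_of_mem h, Set.indicator_of_mem (hiff.1 h)]; rfl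
      · rw [Set.indicator_of_notMem h, Set.indicator_of_notMem (fun h' => h (hiff.2 h'))]
    rw [e, lintegral_indicator_one measurableSet_Ico, Real.volume_Ico, max_sub_min_eq_abs,
      abs_sub_comm]
  calc ∫⁻ u, ENNReal.ofReal |quantile μ u - quantile ν u| ∂lam
      = ∫⁻ u, (∫⁻ t, S.indicator 1 (u, t)) ∂lam := setLIntegral_congr_fun measurableSet_Ioo key
    _ = ∫⁻ t, ∫⁻ u, S.indicator 1 (u, t) ∂lam := by
        apply lintegral_lintegral_swap (f := fun u t => S.indicator (1 : ℝ × ℝ → ℝ≥0∞) (u, t))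
        exact (measurable_one.indicator hSm).aemeasurable
    _ ≤ _ := by
        refine lintegral_mono fun t => ?_
        calc ∫⁻ u, S.indicator 1 (u, t) ∂lam
            ≤ ∫⁻ u, S.indicator 1 (u, t) := lintegral_mono' Measure.restrict_le_self le_rfl
          _ = ∫⁻ u, (Set.Ioc (min (F t) (G t)) (max (F t) (G t))).indicator 1 u := rfl
          _ = _ := by
            rw [lintegral_indicator_one measurableSet_Ioc, Real.volume_Ioc, max_sub_min_eq_abs,
              abs_sub_comm, hF, hG, ProbabilityTheory.cdf_eq_real, ProbabilityTheory.cdf_eq_real]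

/-! ### Empirical measures and centred indicator sums. -/

variable {Ω : Type u}

lemma empirical_apply (X : ℤ → Ω → ℝ) (n : ℕ) (ω : Ω) {s : Set ℝ} (hs : MeasurableSet s) :
    empirical X n ω s =
      (n : ℝ≥0∞)⁻¹ * ∑ k ∈ Finset.Icc 1 n, s.indicator 1 (X (k : ℤ) ω) := by
  simp [empirical, Measure.dirac_apply' _ hs]

lemma isProbabilityMeasure_empirical (X : ℤ → Ω → ℝ) {n : ℕ} (hn : 1 ≤ n) (ω : Ω) :
    IsProbabilityMeasure (empirical X n ω) := by
  refine ⟨?_⟩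
  rw [empirical_apply X n ω MeasurableSet.univ]
  simp only [Set.indicator_univ, Pi.one_apply, Finset.sum_const, Nat.card_Icc, nsmul_eq_mul,
    mul_one, Nat.add_sub_cancel]
  exact ENNReal.inv_mul_cancel (by simp; omega) (by simp)

lemma mul_empirical_real (X : ℤ → Ω → ℝ) {n : ℕ} (hn : 1 ≤ n) (ω : Ω) {s : Set ℝ}
    (hs : MeasurableSet s) :
    (n : ℝ) * (empirical X n ω).real s = ∑ k ∈ Finset.Icc 1 n, s.indicator 1 (X (k : ℤ) ω) := by
  have hn' : (n : ℝ) ≠ 0 := by positivity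
  have e : ∀ k : ℕ, (s.indicator (1 : ℝ → ℝ≥0∞) (X (k : ℤ) ω)).toReal =
      s.indicator (1 : ℝ → ℝ) (X (k : ℤ) ω) := by
    intro k
    by_cases h : X (k : ℤ) ω ∈ s <;> simp [h]
  rw [Measure.real, empirical_apply X n ω hs, ENNReal.toReal_mul, ENNReal.toReal_sum]
  · simp only [e, ENNReal.toReal_inv, ENNReal.toReal_natCast]
    field_simp
  · intro k _
    by_cases h : X (k : ℤ) ω ∈ s <;> simp [h]

/-- The centred empirical sum `∑_{i=1}^k (1_S(X_i) - P(X_0 ∈ S))`. -/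
noncomputable def indicatorSum [MeasurableSpace Ω] (X : ℤ → Ω → ℝ) (P : Measure Ω) (S : Set ℝ)
    (k : ℕ) (ω : Ω) : ℝ :=
  ∑ i ∈ Finset.Icc 1 k, (S.indicator 1 (X (i : ℤ) ω) - P.real {ω | X 0 ω ∈ S})

lemma mul_W1_empirical_le [MeasurableSpace Ω] (X : ℤ → Ω → ℝ) (P : Measure Ω)
    [IsProbabilityMeasure P] (hX : Measurable (X 0)) {n : ℕ} (hn : 1 ≤ n) (ω : Ω) :
    (n : ℝ≥0∞) * W1 (empirical X n ω) (P.map (X 0)) ≤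
      ∫⁻ t, ENNReal.ofReal |indicatorSum X P (Set.Iic t) n ω| := by
  have := isProbabilityMeasure_empirical X hn ω
  have : IsProbabilityMeasure (P.map (X 0)) := Measure.isProbabilityMeasure_map hX.aemeasurable
  calc (n : ℝ≥0∞) * W1 (empirical X n ω) (P.map (X 0))
      ≤ n * ∫⁻ t, ENNReal.ofReal |(empirical X n ω).real (Set.Iic t) -
          (P.map (X 0)).real (Set.Iic t)| := by gcongr; exact W1_le_lintegral _ _
    _ = ∫⁻ t, n * ENNReal.ofReal |(empirical X n ω).real (Set.Iic t) -
          (P.map (X 0)).real (Set.Iic t)| := (lintegral_const_mul' _ _ (by simp)).symm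
    _ = _ := by
      refine lintegral_congr fun t => ?_
      rw [← ENNReal.ofReal_natCast, ← ENNReal.ofReal_mul (by positivity)]
      congr 1
      rw [← Nat.abs_cast n, ← abs_mul, mul_sub, mul_empirical_real X hn ω
        measurableSet_Iic, indicatorSum, Finset.sum_sub_distrib, Finset.sum_const, Nat.card_Icc,
        nsmul_eq_mul, Nat.add_sub_cancel, map_measureReal_apply hX measurableSet_Iic]
      rfl

end MixingLIL

namespace MixingLIL

/-! ### A maximal inequality for exponentially compensated sums. -/

section Maximal

variable {Ω : Type u} {mΩ : MeasurableSpace Ω}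

/-- The running maximum of a real sequence, started at the level `p`. -/
noncomputable def runMax (p : ℝ) (z : ℕ → ℝ) : ℕ → ℝ
  | 0 => p
  | k + 1 => max (runMax p z k) (z (k + 1))

lemma le_runMax_succ (p : ℝ) (z : ℕ → ℝ) (k : ℕ) : runMax p z k ≤ runMax p z (k + 1) :=
  le_max_left _ _

lemma monotone_runMax (p : ℝ) (z : ℕ → ℝ) : Monotone (runMax p z) :=
  monotone_nat_of_le_succ (le_runMax_succ p z)

lemma le_runMax_self {p : ℝ} {z : ℕ → ℝ} (h0 : z 0 ≤ p) : ∀ k, z k ≤ runMax p z k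
  | 0 => h0
  | _ + 1 => le_max_right _ _

lemma level_le_runMax (p : ℝ) (z : ℕ → ℝ) (k : ℕ) : p ≤ runMax p z k :=
  monotone_runMax p z (Nat.zero_le k)

/-- The exponential compensator `E(exp(U_k) - 1 | G_k)`. -/
noncomputable def expComp (P : Measure Ω) (G : ℕ → MeasurableSpace Ω) (U : ℕ → Ω → ℝ) (k : ℕ) :
    Ω → ℝ :=
  P[fun ω => Real.exp (U k ω) - 1 | G k]

/-- The compensated sums whose exponential is a supermartingale. -/
noncomputable def compSum (P : Measure Ω) (G : ℕ → MeasurableSpace Ω) (U : ℕ → Ω → ℝ) (k : ℕ)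
    (ω : Ω) : ℝ :=
  ∑ j ∈ Finset.range k, (U j ω - expComp P G U j ω)

/-- Raising the maximum never increases the potential: a new record `z ≥ m` turns `m + exp(z - m)`
into `z + 1`, and `1 + y ≤ exp y`. -/
lemma max_add_exp_sub_le (m z : ℝ) : max m z + Real.exp (z - max m z) ≤ m + Real.exp (z - m) := by
  rcases le_total z m with h | h
  · rw [max_eq_left h]
  · rw [max_eq_right h, sub_self, Real.exp_zero]
    linarith [Real.add_one_le_exp (z - m)]

variable {P : Measure Ω} {G : ℕ → MeasurableSpace Ω} {U : ℕ → Ω → ℝ}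

lemma stronglyMeasurable_compSum (hG : Monotone G) (hU : ∀ k, Measurable[G (k + 1)] (U k)) (k : ℕ) :
    StronglyMeasurable[G k] (compSum P G U k) := by
  unfold compSum
  refine Finset.stronglyMeasurable_fun_sum _ fun j hj => ?_
  have hj' := Finset.mem_range.1 hj
  exact ((hU j).stronglyMeasurable.mono (hG hj')).sub
    (stronglyMeasurable_condExp.mono (hG hj'.le))

lemma stronglyMeasurable_runMax_compSum (hG : Monotone G)
    (hU : ∀ k, Measurable[G (k + 1)] (U k)) (p : ℝ) (k : ℕ) :
    StronglyMeasurable[G k] (fun ω => runMax p (fun i => compSum P G U i ω) k) := by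
  induction k with
  | zero => exact stronglyMeasurable_const
  | succ k ih =>
    exact continuous_max.comp_stronglyMeasurable
      ((ih.mono (hG k.le_succ)).prodMk (stronglyMeasurable_compSum hG hU (k + 1)))

lemma ae_abs_expComp_le (hb : ∀ k ω, |U k ω| ≤ 1) (k : ℕ) : ∀ᵐ ω ∂P, |expComp P G U k ω| ≤ 2 := by
  refine ae_bdd_abs_condExp_of_ae_bdd_abs (R := (2 : ℝ)) (ae_of_all _ fun ω => ?_)
  have := Real.abs_exp_sub_one_le (hb k ω)
  linarith [hb k ω]

variable [IsProbabilityMeasure P]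

lemma integrable_exp_sub_one (hG : ∀ k, G k ≤ mΩ) (hU : ∀ k, Measurable[G (k + 1)] (U k))
    (hb : ∀ k ω, |U k ω| ≤ 1) (k : ℕ) : Integrable (fun ω => Real.exp (U k ω) - 1) P := by
  have := (hU k).mono (hG (k + 1)) le_rfl
  refine Integrable.of_bound (by fun_prop) 2 (ae_of_all _ fun ω => ?_)
  rw [Real.norm_eq_abs]
  linarith [Real.abs_exp_sub_one_le (hb k ω), hb k ω]

lemma integrable_compSum (hG : ∀ k, G k ≤ mΩ) (hU : ∀ k, Measurable[G (k + 1)] (U k))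
    (hb : ∀ k ω, |U k ω| ≤ 1) (k : ℕ) : Integrable (compSum P G U k) P := by
  unfold compSum
  refine integrable_finsetSum _ fun j _ => ?_
  refine Integrable.sub ?_ integrable_condExp
  exact Integrable.of_bound ((hU j).mono (hG _) le_rfl).aestronglyMeasurable 1
    (ae_of_all _ fun ω => hb j ω)

lemma integrable_runMax_compSum (hG : ∀ k, G k ≤ mΩ) (hU : ∀ k, Measurable[G (k + 1)] (U k))
    (hb : ∀ k ω, |U k ω| ≤ 1) (p : ℝ) (k : ℕ) :
    Integrable (fun ω => runMax p (fun i => compSum P G U i ω) k) P := by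
  induction k with
  | zero => exact integrable_const _
  | succ k ih => exact ih.sup (integrable_compSum hG hU hb (k + 1))

/-- A maximal inequality for conditionally compensated sums: the potential
`max(p, z_1, …, z_k) + exp(z_k - max(p, z_1, …, z_k))` decreases in mean. -/
theorem integral_runMax_compSum_le (hm : Monotone G) (hG : ∀ k, G k ≤ mΩ)
    (hU : ∀ k, Measurable[G (k + 1)] (U k)) (hb : ∀ k ω, |U k ω| ≤ 1) {p : ℝ} (hp : 0 ≤ p) (N : ℕ) :
    ∫ ω, runMax p (fun i => compSum P G U i ω) N ∂P ≤ p + Real.exp (-p) := by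
  set z : ℕ → Ω → ℝ := compSum P G U with hz
  set m : ℕ → Ω → ℝ := fun k ω => runMax p (fun i => z i ω) k with hmdef
  have hz0 : ∀ ω, z 0 ω = 0 := fun ω => by simp [hz, compSum]
  have hzm : ∀ k ω, z k ω ≤ m k ω := fun k ω =>
    le_runMax_self (z := fun i => z i ω) ((hz0 ω).trans_le hp) k
  have zs := stronglyMeasurable_compSum (P := P) hm hU
  have ms := stronglyMeasurable_runMax_compSum (P := P) hm hU p
  have mi : ∀ k, Integrable (m k) P := integrable_runMax_compSum (P := P) hG hU hb p
  set W : ℕ → Ω → ℝ := fun k ω => Real.exp (z k ω - m k ω) with hW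
  have Ws : ∀ k, StronglyMeasurable[G k] (W k) := fun k =>
    Real.continuous_exp.comp_stronglyMeasurable ((zs k).sub (ms k))
  have W0 : ∀ k ω, 0 ≤ W k ω := fun k ω => (Real.exp_pos _).le
  have W1 : ∀ k ω, W k ω ≤ 1 := fun k ω => Real.exp_le_one_iff.2 (sub_nonpos.2 (hzm k ω))
  have Wi : ∀ k, Integrable (W k) P := fun k =>
    Integrable.of_bound ((Ws k).mono (hG k)).aestronglyMeasurable 1
      (ae_of_all _ fun ω => by rw [Real.norm_of_nonneg (W0 k ω)]; exact W1 k ω)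
  have step : ∀ k, ∫ ω, (m (k + 1) ω + W (k + 1) ω) ∂P ≤ ∫ ω, (m k ω + W k ω) ∂P := by
    intro k
    set φ := expComp P G U k with hφ
    have φs : StronglyMeasurable[G k] φ := stronglyMeasurable_condExp
    -- The `G k`-measurable factor of the next exponential: `exp(z_{k+1} - m_k) = A exp(U_k) = A E +
    -- A`, whose conditional mean is `A (φ + 1)`.
    set A : Ω → ℝ := fun ω => W k ω * Real.exp (-φ ω) with hA
    set E : Ω → ℝ := fun ω => Real.exp (U k ω) - 1 with hE
    have As : StronglyMeasurable[G k] A :=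
      (Ws k).mul (Real.continuous_exp.comp_stronglyMeasurable φs.neg)
    have Ab : ∀ᵐ ω ∂P, ‖A ω‖ ≤ Real.exp 2 := by
      filter_upwards [ae_abs_expComp_le (P := P) (G := G) hb k] with ω hω
      change ‖W k ω * Real.exp (-φ ω)‖ ≤ _
      rw [norm_mul, Real.norm_of_nonneg (W0 k ω), Real.norm_of_nonneg (Real.exp_pos _).le]
      calc W k ω * Real.exp (-φ ω) ≤ 1 * Real.exp 2 := by
            gcongr
            · exact W1 k ω
            · linarith [(abs_le.1 hω).1]
        _ = _ := one_mul _
    have Ei : Integrable E P := integrable_exp_sub_one hG hU hb k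
    have Ai : Integrable A P :=
      Integrable.of_bound (As.mono (hG k)).aestronglyMeasurable _ Ab
    have AEi : Integrable (fun ω => A ω * E ω) P :=
      Ei.bdd_mul (As.mono (hG k)).aestronglyMeasurable Ab
    have Aφi : Integrable (fun ω => A ω * φ ω) P :=
      integrable_condExp.bdd_mul (As.mono (hG k)).aestronglyMeasurable Ab
    have AEA : Integrable (fun ω => A ω * E ω + A ω) P := AEi.add Ai
    have pull : ∫ ω, A ω * E ω ∂P = ∫ ω, A ω * φ ω ∂P := by
      have h := condExp_stronglyMeasurable_mul_of_bound (hG k) As Ei _ Ab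
      rw [← integral_condExp (hG k)]
      exact integral_congr_ae h
    calc ∫ ω, (m (k + 1) ω + W (k + 1) ω) ∂P
        ≤ ∫ ω, (m k ω + (A ω * E ω + A ω)) ∂P := by
          refine integral_mono ((mi _).add (Wi _)) ((mi k).add AEA) fun ω => ?_
          have h1 := max_add_exp_sub_le (m k ω) (z (k + 1) ω)
          have h2 : Real.exp (z (k + 1) ω - m k ω) = A ω * E ω + A ω := by
            simp only [hA, hE, hW, hz, compSum, Finset.sum_range_succ, ← hφ]
            rw [← mul_add_one, sub_add_cancel, ← Real.exp_add, ← Real.exp_add]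
            congr 1
            ring
          exact h1.trans_eq (by rw [h2])
      _ = ∫ ω, m k ω ∂P + (∫ ω, A ω * φ ω ∂P + ∫ ω, A ω ∂P) := by
          rw [integral_add (mi k) AEA, integral_add AEi Ai, pull]
      _ = ∫ ω, m k ω ∂P + ∫ ω, (A ω * φ ω + A ω) ∂P := by rw [integral_add Aφi Ai]
      _ ≤ ∫ ω, m k ω ∂P + ∫ ω, W k ω ∂P := by
          gcongr
          · exact Aφi.add Ai
          · exact Wi k
          · intro ω
            simp only [hA]
            -- This is the supermartingale property; no bound on the conditional variance is needed.
            have h1 : Real.exp (-φ ω) * (φ ω + 1) ≤ 1 := by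
              calc _ ≤ Real.exp (-φ ω) * Real.exp (φ ω) := by
                    gcongr; exact Real.add_one_le_exp _
                _ = 1 := by rw [← Real.exp_add]; simp
            nlinarith [W0 k ω]
      _ = _ := (integral_add (mi k) (Wi k)).symm
  have all : ∀ k, ∫ ω, (m k ω + W k ω) ∂P ≤ p + Real.exp (-p) := by
    intro k
    induction k with
    | zero => simp [hmdef, runMax, hW, hz0]
    | succ k ih => exact (step k).trans ih
  refine le_trans ?_ (all N)
  exact integral_mono (mi N) ((mi N).add (Wi N)) fun ω => by linarith [W0 N ω]

end Maximal

/-! ### Conditional expectations under strong mixing. -/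

section Mixing

variable {Ω : Type u} {mΩ : MeasurableSpace Ω} {P : Measure Ω} [IsProbabilityMeasure P]
  {m m' : MeasurableSpace Ω} {f : Ω → ℝ}

/-- Splitting according to the sign of the fluctuation writes its `L¹` norm as two set integrals
over sets of `m`, each at most `b`. -/
lemma integral_abs_condExp_sub_le_of_setIntegral (hm : m ≤ mΩ) (hf : Integrable f P) {b : ℝ}
    (h : ∀ A, MeasurableSet[m] A → |∫ ω in A, f ω ∂P - P.real A * ∫ ω, f ω ∂P| ≤ b) :
    ∫ ω, |(P[f | m]) ω - ∫ ω', f ω' ∂P| ∂P ≤ 2 * b := by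
  set c := ∫ ω', f ω' ∂P
  set g : Ω → ℝ := fun ω => (P[f | m]) ω - c with hg
  have gs : StronglyMeasurable[m] g := stronglyMeasurable_condExp.sub stronglyMeasurable_const
  have gi : Integrable g P := integrable_condExp.sub (integrable_const c)
  set D : Set Ω := {ω | 0 ≤ g ω} with hD
  have Dm : MeasurableSet[m] D := measurableSet_le (@measurable_const _ _ _ m 0) gs.measurable
  have val : ∀ A, MeasurableSet[m] A → ∫ ω in A, g ω ∂P = ∫ ω in A, f ω ∂P - P.real A * c := by
    intro A hA
    rw [integral_sub integrable_condExp.integrableOn (integrable_const c).integrableOn,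
      setIntegral_condExp hm hf hA, setIntegral_const, smul_eq_mul]
  rw [← integral_add_compl (hm _ Dm) gi.abs]
  have e1 : ∫ ω in D, |g ω| ∂P = ∫ ω in D, g ω ∂P :=
    setIntegral_congr_fun (hm _ Dm) fun ω hω => abs_of_nonneg hω
  have e2 : ∫ ω in Dᶜ, |g ω| ∂P = -∫ ω in Dᶜ, g ω ∂P := by
    rw [← integral_neg]
    exact setIntegral_congr_fun (hm _ Dm).compl fun ω hω =>
      abs_of_neg (not_le.1 hω)
  rw [e1, e2, val _ Dm, val _ Dm.compl]
  linarith [le_abs_self (∫ ω in D, f ω ∂P - P.real D * c), h D Dm, h Dᶜ Dm.compl,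
    neg_abs_le (∫ ω in Dᶜ, f ω ∂P - P.real Dᶜ * c)]

/-- A bounded variable has small conditional mean fluctuation with respect to a nearly
independent σ-algebra. -/
theorem integral_abs_condExp_sub_le (hm : m ≤ mΩ) (hm' : m' ≤ mΩ) {a M : ℝ}
    (hα : ∀ A B, MeasurableSet[m] A → MeasurableSet[m'] B →
      |P.real (A ∩ B) - P.real A * P.real B| ≤ a)
    (hf : Measurable[m'] f) (hM : ∀ ω, |f ω| ≤ M) :
    ∫ ω, |(P[f | m]) ω - ∫ ω', f ω' ∂P| ∂P ≤ 4 * M * a := by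
  have hfi : Integrable f P := Integrable.of_bound (hf.mono hm' le_rfl).aestronglyMeasurable M
    (ae_of_all _ hM)
  -- Duality, using the sign lemma twice: first the indicator of `A` is conditioned on `m'`, with
  -- fluctuation at most `2a`; pairing it with `f` gives `2Ma` on each set of `m`, and a second use
  -- gives `4Ma`.
  have main : ∫ ω, |(P[f | m]) ω - ∫ ω', f ω' ∂P| ∂P ≤ 2 * (M * (2 * a)) := by
    refine integral_abs_condExp_sub_le_of_setIntegral hm hfi fun A hA => ?_
    set g : Ω → ℝ := A.indicator 1 with hg
    have gi : Integrable g P := (integrable_const (1 : ℝ)).indicator (hm _ hA)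
    have g1 : ∫ ω, g ω ∂P = P.real A := integral_indicator_one (hm _ hA)
    have hg2 : ∫ ω, |(P[g | m']) ω - ∫ ω', g ω' ∂P| ∂P ≤ 2 * a := by
      refine integral_abs_condExp_sub_le_of_setIntegral hm' gi fun B hB => ?_
      have : ∫ ω in B, g ω ∂P = P.real (A ∩ B) := by
        rw [hg, integral_indicator_one (hm _ hA), measureReal_restrict_apply (hm _ hA)]
      rw [this, g1, mul_comm]
      exact hα A B hA hB
    have fs : StronglyMeasurable[m'] f := hf.stronglyMeasurable
    have fb : ∀ᵐ ω ∂P, ‖f ω‖ ≤ M := ae_of_all _ hM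
    have fm : AEStronglyMeasurable[mΩ] f P := (hf.mono hm' le_rfl).aestronglyMeasurable
    have e1 : ∫ ω in A, f ω ∂P = ∫ ω, f ω * (P[g | m']) ω ∂P := by
      calc ∫ ω in A, f ω ∂P = ∫ ω, f ω * g ω ∂P := by
            rw [← integral_indicator (hm _ hA)]
            refine integral_congr_ae (ae_of_all _ fun ω => ?_)
            by_cases hω : ω ∈ A <;> simp [hg, hω]
        _ = _ := by
          rw [← integral_condExp hm']
          exact integral_congr_ae (condExp_stronglyMeasurable_mul_of_bound hm' fs gi M fb)
    have e2 : ∫ ω in A, f ω ∂P - P.real A * ∫ ω, f ω ∂P =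
        ∫ ω, f ω * ((P[g | m']) ω - ∫ ω', g ω' ∂P) ∂P := by
      rw [e1, g1, ← integral_const_mul, ← integral_sub]
      · refine integral_congr_ae (ae_of_all _ fun ω => ?_)
        simp only
        ring
      · exact integrable_condExp.bdd_mul fm fb
      · exact hfi.const_mul _
    have di : Integrable (fun ω => (P[g | m']) ω - ∫ ω', g ω' ∂P) P :=
      integrable_condExp.sub (integrable_const _)
    have hM0 : 0 ≤ M := by
      obtain ⟨ω⟩ : Nonempty Ω := nonempty_of_isProbabilityMeasure P
      exact (abs_nonneg _).trans (hM ω)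
    rw [e2]
    calc _ ≤ ∫ ω, |f ω * ((P[g | m']) ω - ∫ ω', g ω' ∂P)| ∂P := abs_integral_le_integral_abs
      _ ≤ ∫ ω, M * |(P[g | m']) ω - ∫ ω', g ω' ∂P| ∂P := by
          refine integral_mono (di.bdd_mul fm fb).abs (di.abs.const_mul M) fun ω => ?_
          simp only [abs_mul]
          gcongr
          exact hM ω
      _ ≤ _ := by
          rw [integral_const_mul]
          gcongr
  linarith

end Mixing

end MixingLIL

/-! ### Stationarity: mixing across a gap placed anywhere. -/

namespace MixingLIL

variable {Ω : Type u} [MeasurableSpace Ω] {X : ℤ → Ω → ℝ} {P : Measure Ω}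

/-- The σ-algebra `σ(X_i, i ≤ m)`. -/
@[reducible] def pastAt {Ω : Type u} (X : ℤ → Ω → ℝ) (m : ℤ) : MeasurableSpace Ω :=
  ⨆ i : ℤ, ⨆ _ : i ≤ m, MeasurableSpace.comap (X i) inferInstance

/-- The σ-algebra `σ(X_i, i ≥ m)`. -/
@[reducible] def futureAt {Ω : Type u} (X : ℤ → Ω → ℝ) (m : ℤ) : MeasurableSpace Ω :=
  ⨆ i : ℤ, ⨆ _ : m ≤ i, MeasurableSpace.comap (X i) inferInstance

lemma pastAt_le (hX : ∀ i, Measurable (X i)) (m : ℤ) : pastAt X m ≤ ‹MeasurableSpace Ω› :=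
  iSup₂_le fun i _ => (hX i).comap_le

lemma futureAt_le (hX : ∀ i, Measurable (X i)) (m : ℤ) : futureAt X m ≤ ‹MeasurableSpace Ω› :=
  iSup₂_le fun i _ => (hX i).comap_le

lemma pastAt_mono {Ω : Type u} (X : ℤ → Ω → ℝ) : Monotone (pastAt X) := fun _ _ h =>
  iSup₂_le fun i hi => le_iSup₂_of_le i (hi.trans h) le_rfl

lemma measurable_pastAt {Ω : Type u} (X : ℤ → Ω → ℝ) {i m : ℤ} (h : i ≤ m) :
    Measurable[pastAt X m] (X i) :=
  measurable_iff_comap_le.2 (le_iSup₂_of_le i h le_rfl)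

lemma measurable_futureAt {Ω : Type u} (X : ℤ → Ω → ℝ) {i m : ℤ} (h : m ≤ i) :
    Measurable[futureAt X m] (X i) :=
  measurable_iff_comap_le.2 (le_iSup₂_of_le i h le_rfl)

/-- The σ-algebra on `ℤ → ℝ` generated by the coordinates satisfying `p`. -/
@[reducible] def coordAlg (p : ℤ → Prop) : MeasurableSpace (ℤ → ℝ) :=
  ⨆ i : ℤ, ⨆ _ : p i, MeasurableSpace.comap (fun x : ℤ → ℝ => x i) inferInstance

lemma coordAlg_le (p : ℤ → Prop) : coordAlg p ≤ MeasurableSpace.pi :=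
  iSup₂_le fun i _ => (measurable_pi_apply i).comap_le

lemma comap_shift_coordAlg {Ω : Type u} (X : ℤ → Ω → ℝ) (h : ℤ) (p : ℤ → Prop) :
    (coordAlg p).comap (fun ω (i : ℤ) => X (i + h) ω) =
      ⨆ i : ℤ, ⨆ _ : p i, MeasurableSpace.comap (X (i + h)) inferInstance := by
  simp only [coordAlg, MeasurableSpace.comap_iSup, MeasurableSpace.comap_comp]
  rfl

lemma comap_coordAlg {Ω : Type u} (X : ℤ → Ω → ℝ) (p : ℤ → Prop) :
    (coordAlg p).comap (fun ω (i : ℤ) => X i ω) =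
      ⨆ i : ℤ, ⨆ _ : p i, MeasurableSpace.comap (X i) inferInstance := by
  simp only [coordAlg, MeasurableSpace.comap_iSup, MeasurableSpace.comap_comp]
  rfl

/-- Events before time `m` are pulled back along the sequence shifted by `m`, so their probabilities
can be moved to time `0` by stationarity. -/
lemma pastAt_le_comap {Ω : Type u} (X : ℤ → Ω → ℝ) (m : ℤ) :
    pastAt X m ≤ (coordAlg (· ≤ 0)).comap (fun ω (i : ℤ) => X (i + m) ω) := by
  rw [comap_shift_coordAlg]
  refine iSup₂_le fun i hi => le_iSup₂_of_le (i - m) (by omega) ?_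
  rw [sub_add_cancel]

lemma futureAt_le_comap {Ω : Type u} (X : ℤ → Ω → ℝ) (m : ℤ) (k : ℕ) :
    futureAt X (m + k) ≤ (coordAlg ((k : ℤ) ≤ ·)).comap (fun ω (i : ℤ) => X (i + m) ω) := by
  rw [comap_shift_coordAlg]
  refine iSup₂_le fun i hi => le_iSup₂_of_le (i - m) (by omega) ?_
  rw [sub_add_cancel]

lemma StrictlyStationary.measureReal_preimage (hs : StrictlyStationary X P)
    (hX : ∀ i, Measurable (X i)) (h : ℤ) {A : Set (ℤ → ℝ)} (hA : MeasurableSet A) :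
    P.real ((fun ω (i : ℤ) => X (i + h) ω) ⁻¹' A) = P.real ((fun ω (i : ℤ) => X i ω) ⁻¹' A) := by
  rw [← map_measureReal_apply (measurable_pi_lambda _ fun i => hX _) hA,
    ← map_measureReal_apply (measurable_pi_lambda _ fun i => hX _) hA, hs h]

lemma StrictlyStationary.measureReal_mem (hs : StrictlyStationary X P)
    (hX : ∀ i, Measurable (X i)) (i : ℤ) {S : Set ℝ} (hS : MeasurableSet S) :
    P.real {ω | X i ω ∈ S} = P.real {ω | X 0 ω ∈ S} := by
  have := hs.measureReal_preimage hX i (A := {x | x 0 ∈ S}) (measurable_pi_apply 0 hS)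
  simpa using this

lemma abs_measureReal_inter_sub_le_one [IsProbabilityMeasure P] (A B : Set Ω) :
    |P.real (A ∩ B) - P.real A * P.real B| ≤ 1 := by
  have h1 : P.real (A ∩ B) ≤ 1 := measureReal_le_one
  have h2 : P.real A ≤ 1 := measureReal_le_one
  have h3 : P.real B ≤ 1 := measureReal_le_one
  have h4 : 0 ≤ P.real (A ∩ B) := measureReal_nonneg
  have h5 : 0 ≤ P.real A := measureReal_nonneg
  have h6 : 0 ≤ P.real B := measureReal_nonneg
  rw [abs_le]
  constructor <;> nlinarith

lemma le_alpha [IsProbabilityMeasure P] {k : ℕ} {A B : Set Ω} (hA : MeasurableSet[past X] A)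
    (hB : MeasurableSet[future X k] B) :
    |P.real (A ∩ B) - P.real A * P.real B| ≤ alpha X P k := by
  refine le_csSup ⟨1, ?_⟩ ⟨A, B, hA, hB, rfl⟩
  rintro r ⟨A, B, -, -, rfl⟩
  exact abs_measureReal_inter_sub_le_one A B

lemma alpha_nonneg [IsProbabilityMeasure P] (k : ℕ) : 0 ≤ alpha X P k :=
  (abs_nonneg _).trans (le_alpha (X := X) (k := k) (A := ∅) (B := ∅)
    (@MeasurableSet.empty _ (past X)) (@MeasurableSet.empty _ (future X k)))

lemma antitone_alpha [IsProbabilityMeasure P] : Antitone (alpha X P) := by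
  intro k l hkl
  refine csSup_le ⟨_, ∅, ∅, @MeasurableSet.empty _ (past X), @MeasurableSet.empty _ (future X l),
    rfl⟩ ?_
  rintro r ⟨A, B, hA, hB, rfl⟩
  refine le_alpha hA ?_
  have : future X l ≤ future X k :=
    iSup₂_le fun i hi => le_iSup₂_of_le i (by omega) le_rfl
  exact this _ hB

/-- The mixing coefficients control the dependence across a gap starting at any time. -/
lemma StrictlyStationary.abs_sub_le_alpha [IsProbabilityMeasure P] (hs : StrictlyStationary X P)
    (hX : ∀ i, Measurable (X i)) {m : ℤ} {k : ℕ} {A B : Set Ω} (hA : MeasurableSet[pastAt X m] A)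
    (hB : MeasurableSet[futureAt X (m + k)] B) :
    |P.real (A ∩ B) - P.real A * P.real B| ≤ alpha X P k := by
  obtain ⟨A', hA', rfl⟩ := pastAt_le_comap X m A hA
  obtain ⟨B', hB', rfl⟩ := futureAt_le_comap X m k B hB
  have hA2 := coordAlg_le _ _ hA'
  have hB2 := coordAlg_le _ _ hB'
  rw [← Set.preimage_inter, hs.measureReal_preimage hX m hA2, hs.measureReal_preimage hX m hB2,
    hs.measureReal_preimage hX m (hA2.inter hB2)]
  refine le_alpha ?_ ?_
  · have : past X = (coordAlg (· ≤ 0)).comap (fun ω (i : ℤ) => X i ω) := (comap_coordAlg X _).symm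
    rw [this]
    exact ⟨A', hA', rfl⟩
  · have : future X k = (coordAlg ((k : ℤ) ≤ ·)).comap (fun ω (i : ℤ) => X i ω) :=
      (comap_coordAlg X _).symm
    rw [this]
    exact ⟨B', hB', rfl⟩

/-! ### Truncated coefficients and moments of centred indicators. -/

/-- The truncated mixing coefficients `α(k) ∧ h`. -/
noncomputable def mixMin (X : ℤ → Ω → ℝ) (P : Measure Ω) (h : ℝ) (k : ℕ) : ℝ :=
  min (alpha X P k) h

lemma mixMin_nonneg [IsProbabilityMeasure P] {h : ℝ} (hh : 0 ≤ h) (k : ℕ) : 0 ≤ mixMin X P h k :=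
  le_min (alpha_nonneg k) hh

lemma antitone_mixMin [IsProbabilityMeasure P] (h : ℝ) : Antitone (mixMin X P h) := fun _ _ hkl =>
  min_le_min_right _ (antitone_alpha hkl)

/-- Moment bounds, at the level `h`, for the stationary sequence `f(X_i)`. -/
structure MomentBounds (X : ℤ → Ω → ℝ) (P : Measure Ω) (h : ℝ) (f : ℝ → ℝ) : Prop where
  measurable : Measurable f
  abs_le_one : ∀ x, |f x| ≤ 1
  integral_eq_zero : ∀ i, ∫ ω, f (X i ω) ∂P = 0
  integral_abs_le : ∀ i, ∫ ω, |f (X i ω)| ∂P ≤ 2 * mixMin X P h 0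
  abs_integral_mul_le : ∀ i j, |∫ ω, f (X i ω) * f (X j ω) ∂P| ≤ mixMin X P h (i - j).natAbs

lemma MomentBounds.neg {h : ℝ} {f : ℝ → ℝ} (hf : MomentBounds X P h f) :
    MomentBounds X P h (fun x => -f x) where
  measurable := hf.measurable.neg
  abs_le_one x := by simpa using hf.abs_le_one x
  integral_eq_zero i := by rw [integral_neg, hf.integral_eq_zero, neg_zero]
  integral_abs_le i := by simpa using hf.integral_abs_le i
  abs_integral_mul_le i j := by simpa using hf.abs_integral_mul_le i j

lemma integral_centered_mul [IsProbabilityMeasure P] {A B : Set Ω} (hA : MeasurableSet A)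
    (hB : MeasurableSet B) (p : ℝ) (hpA : P.real A = p) (hpB : P.real B = p) :
    ∫ ω, (A.indicator 1 ω - p) * (B.indicator 1 ω - p) ∂P = P.real (A ∩ B) - p * p := by
  have e : ∀ ω, (A.indicator (1 : Ω → ℝ) ω - p) * (B.indicator (1 : Ω → ℝ) ω - p) =
      (A ∩ B).indicator (1 : Ω → ℝ) ω - p * A.indicator (1 : Ω → ℝ) ω
        - p * B.indicator (1 : Ω → ℝ) ω + p * p := by
    intro ω
    by_cases h1 : ω ∈ A <;> by_cases h2 : ω ∈ B <;> simp [h1, h2] <;> ring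
  have i1 : ∀ S : Set Ω, MeasurableSet S → Integrable (S.indicator (1 : Ω → ℝ)) P := fun S hS =>
    (integrable_const (1 : ℝ)).indicator hS
  have a1 := i1 _ (hA.inter hB)
  have a2 := (i1 _ hA).const_mul p
  have a3 := (i1 _ hB).const_mul p
  have a4 : Integrable (fun ω => (A ∩ B).indicator (1 : Ω → ℝ) ω - p * A.indicator 1 ω) P :=
    a1.sub a2
  have a5 : Integrable (fun ω => (A ∩ B).indicator (1 : Ω → ℝ) ω - p * A.indicator 1 ω -
    p * B.indicator 1 ω) P := a4.sub a3
  simp_rw [e]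
  rw [integral_add a5 (integrable_const _), integral_sub a4 a3, integral_sub a1 a2,
    integral_const_mul, integral_const_mul, integral_indicator_one (hA.inter hB),
    integral_indicator_one hA, integral_indicator_one hB, hpA, hpB]
  simp

/-- The covariances of the indicators are bounded by `α` through mixing, and by `h` trivially since
`S` has probability at most `h`. -/
lemma momentBounds_indicator [IsProbabilityMeasure P] (hs : StrictlyStationary X P)
    (hX : ∀ i, Measurable (X i)) {S : Set ℝ} (hS : MeasurableSet S) {h : ℝ}
    (hh : P.real {ω | X 0 ω ∈ S} ≤ h) :
    MomentBounds X P h (fun x => S.indicator 1 x - P.real {ω | X 0 ω ∈ S}) := by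
  set p := P.real {ω | X 0 ω ∈ S} with hp
  have p0 : 0 ≤ p := measureReal_nonneg
  have p1 : p ≤ 1 := measureReal_le_one
  set A : ℤ → Set Ω := fun i => {ω | X i ω ∈ S} with hA
  have Am : ∀ i, MeasurableSet (A i) := fun i => hX i hS
  have Ap : ∀ i, P.real (A i) = p := fun i => hs.measureReal_mem hX i hS
  have ind : ∀ i ω, S.indicator (1 : ℝ → ℝ) (X i ω) = (A i).indicator (1 : Ω → ℝ) ω :=
    fun i ω => rfl
  have Ai : ∀ i, Integrable ((A i).indicator (1 : Ω → ℝ)) P := fun i =>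
    (integrable_const (1 : ℝ)).indicator (Am i)
  have cov : ∀ i j, ∫ ω, (S.indicator (1 : ℝ → ℝ) (X i ω) - p) * (S.indicator 1 (X j ω) - p) ∂P =
      P.real (A i ∩ A j) - p * p := fun i j =>
    integral_centered_mul (Am i) (Am j) p (Ap i) (Ap j)
  have covle : ∀ i j, i ≤ j → |P.real (A i ∩ A j) - p * p| ≤ mixMin X P h (i - j).natAbs := by
    intro i j hij
    refine le_min ?_ ?_
    · have hB : MeasurableSet[futureAt X (i + ((i - j).natAbs : ℤ))] (A j) :=
        measurable_futureAt X (by omega) hS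
      have := hs.abs_sub_le_alpha hX (measurable_pastAt X le_rfl hS) hB
      rwa [show P.real (X i ⁻¹' S) = p from Ap i, Ap j] at this
    · have h1 : P.real (A i ∩ A j) ≤ p := (measureReal_mono Set.inter_subset_left).trans_eq (Ap i)
      have h2 : 0 ≤ P.real (A i ∩ A j) := measureReal_nonneg
      rw [abs_le]
      constructor <;> nlinarith
  have covle' : ∀ i j, |P.real (A i ∩ A j) - p * p| ≤ mixMin X P h (i - j).natAbs := by
    intro i j
    rcases le_total i j with hij | hij
    · exact covle i j hij
    · rw [Set.inter_comm, show (i - j).natAbs = (j - i).natAbs by omega]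
      exact covle j i hij
  refine ⟨(measurable_one.indicator hS).sub_const p, fun x => ?_, fun i => ?_, fun i => ?_,
    fun i j => ?_⟩
  · by_cases hx : x ∈ S
    · simp only [hx, Set.indicator_of_mem, Pi.one_apply]
      rw [abs_le]; constructor <;> linarith
    · simp only [hx, not_false_eq_true, Set.indicator_of_notMem]
      rw [abs_le]; constructor <;> linarith
  · simp only [ind]
    rw [integral_sub (Ai i) (integrable_const _), integral_indicator_one (Am i), Ap]
    simp
  -- The absolute mean equals `2p(1 - p)`, twice the variance, so the covariance bound at lag `0`
  -- yields `α(0) ∧ h` rather than only `h`. This sharper form serves levels where the block length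
  -- is zero.
  · have e : ∀ ω, |S.indicator (1 : ℝ → ℝ) (X i ω) - p| =
        (1 - 2 * p) * (A i).indicator (1 : Ω → ℝ) ω + p := by
      intro ω
      rw [ind]
      by_cases hω : ω ∈ A i
      · simp only [hω, Set.indicator_of_mem, Pi.one_apply]
        rw [abs_of_nonneg (by linarith)]; ring
      · simp only [hω, not_false_eq_true, Set.indicator_of_notMem]
        rw [zero_sub, abs_neg, abs_of_nonneg p0]; ring
    simp_rw [e]
    rw [integral_add ((Ai i).const_mul _) (integrable_const _), integral_const_mul,
      integral_indicator_one (Am i), Ap]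
    have h1 := (le_abs_self _).trans (covle' i i)
    rw [Set.inter_self, Ap, sub_self, Int.natAbs_zero] at h1
    simp
    linarith
  · rw [cov]
    exact covle' i j

/-! ### Variances of partial sums. -/

section Blocks

variable {h : ℝ} {f : ℝ → ℝ}

/-- The map `j ↦ |i - j|` is injective on each side of `i`, so each lag occurs at most twice. -/
lemma sum_natAbs_sub_le {g : ℕ → ℝ} (hg0 : ∀ k, 0 ≤ g k) (hg : Summable g) (i : ℤ)
    (s : Finset ℤ) : ∑ j ∈ s, g (i - j).natAbs ≤ 2 * ∑' k, g k := by
  have aux : ∀ t : Finset ℤ, Set.InjOn (fun j : ℤ => (i - j).natAbs) t →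
      ∑ j ∈ t, g (i - j).natAbs ≤ ∑' k, g k := by
    intro t ht
    rw [← Finset.sum_image (f := g) ht]
    exact hg.sum_le_tsum _ fun k _ => hg0 k
  rw [← Finset.sum_filter_add_sum_filter_not s (· ≤ i), two_mul]
  refine add_le_add (aux _ ?_) (aux _ ?_)
  · intro a ha b hb hab
    simp only [Finset.coe_filter, Set.mem_ofPred_eq] at ha hb hab
    omega
  · intro a ha b hb hab
    simp only [Finset.coe_filter, Set.mem_ofPred_eq] at ha hb hab
    omega

lemma MomentBounds.integrable_comp [IsProbabilityMeasure P] (hf : MomentBounds X P h f)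
    (hX : ∀ i, Measurable (X i)) (i : ℤ) : Integrable (fun ω => f (X i ω)) P :=
  Integrable.of_bound (hf.measurable.comp (hX i)).aestronglyMeasurable 1
    (ae_of_all _ fun _ => hf.abs_le_one _)

lemma MomentBounds.integral_sum_sq_le [IsProbabilityMeasure P] (hf : MomentBounds X P h f)
    (hX : ∀ i, Measurable (X i)) (hh : 0 ≤ h) (hsum : Summable (mixMin X P h)) (s : Finset ℤ) :
    ∫ ω, (∑ i ∈ s, f (X i ω)) ^ 2 ∂P ≤ s.card * (2 * ∑' k, mixMin X P h k) := by
  have hint : ∀ i j, Integrable (fun ω => f (X i ω) * f (X j ω)) P := fun i j =>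
    (hf.integrable_comp hX j).bdd_mul (hf.integrable_comp hX i).aestronglyMeasurable
      (ae_of_all _ fun ω => hf.abs_le_one _)
  have e : ∀ ω, (∑ i ∈ s, f (X i ω)) ^ 2 = ∑ i ∈ s, ∑ j ∈ s, f (X i ω) * f (X j ω) := fun ω => by
    rw [sq, Finset.sum_mul_sum]
  simp_rw [e]
  rw [integral_finsetSum _ fun i _ => integrable_finsetSum _ fun j _ => hint i j]
  calc _ = ∑ i ∈ s, ∑ j ∈ s, ∫ ω, f (X i ω) * f (X j ω) ∂P :=
        Finset.sum_congr rfl fun i _ => integral_finsetSum _ fun j _ => hint i j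
    _ ≤ ∑ i ∈ s, ∑ j ∈ s, mixMin X P h (i - j).natAbs :=
        Finset.sum_le_sum fun i _ => Finset.sum_le_sum fun j _ =>
          (le_abs_self _).trans (hf.abs_integral_mul_le i j)
    _ ≤ ∑ i ∈ s, (2 * ∑' k, mixMin X P h k) :=
        Finset.sum_le_sum fun i _ => sum_natAbs_sub_le (mixMin_nonneg hh) hsum i s
    _ = _ := by rw [Finset.sum_const, nsmul_eq_mul]

lemma MomentBounds.abs_sum_le (hf : MomentBounds X P h f) (s : Finset ℤ) (ω : Ω) :
    |∑ i ∈ s, f (X i ω)| ≤ s.card := by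
  refine (Finset.abs_sum_le_sum_abs _ _).trans ?_
  simpa using Finset.sum_le_sum fun i (_ : i ∈ s) => hf.abs_le_one (X i ω)

lemma measurable_sum_comp {Ω : Type u} {m : MeasurableSpace Ω} {X : ℤ → Ω → ℝ} {f : ℝ → ℝ}
    (hf : Measurable f) {s : Finset ℤ} (hX : ∀ i ∈ s, Measurable[m] (X i)) :
    Measurable[m] (fun ω => ∑ i ∈ s, f (X i ω)) :=
  Finset.measurable_fun_sum s fun i hi => hf.comp (hX i hi)

end Blocks

end MixingLIL

/-! ### Exponential compensators of separated blocks. -/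

namespace MixingLIL

variable {Ω : Type u} [MeasurableSpace Ω] {X : ℤ → Ω → ℝ} {P : Measure Ω} [IsProbabilityMeasure P]
  {h : ℝ} {f : ℝ → ℝ}

/-- The `j`-th of a sequence of blocks of length `q`, starting after `s`, with gaps of length `q`. -/
noncomputable def block (s : ℤ) (q j : ℕ) : Finset ℤ :=
  Finset.Ioc (s + 2 * j * q) (s + 2 * j * q + q)

lemma card_block (s : ℤ) (q j : ℕ) : (block s q j).card = q := by
  simp [block]

/-- The fluctuation of the exponential compensator of a block sum. -/
lemma MomentBounds.integral_abs_condExp_block_le (hf : MomentBounds X P h f)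
    (hs : StrictlyStationary X P) (hX : ∀ i, Measurable (X i))
    {q : ℕ} (hq : 1 ≤ q) (s : ℤ) (j : ℕ) :
    ∫ ω, |(P[fun ω => Real.exp ((q : ℝ)⁻¹ * ∑ i ∈ block s q j, f (X i ω)) - 1 |
        pastAt X (s + 2 * j * q - q)]) ω -
      ∫ ω', (Real.exp ((q : ℝ)⁻¹ * ∑ i ∈ block s q j, f (X i ω')) - 1) ∂P| ∂P ≤
      8 * mixMin X P h q := by
  set T : Ω → ℝ := fun ω => (q : ℝ)⁻¹ * ∑ i ∈ block s q j, f (X i ω) with hT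
  have hq0 : (0 : ℝ) < q := by exact_mod_cast hq
  have Tb : ∀ ω, |T ω| ≤ 1 := fun ω => by
    rw [hT, abs_mul, abs_of_pos (inv_pos.2 hq0), inv_mul_le_one₀ hq0]
    exact (hf.abs_sum_le _ ω).trans_eq (by rw [card_block])
  set E : Ω → ℝ := fun ω => Real.exp (T ω) - 1 with hE
  -- The future index is left as the past index plus `q`, exhibiting the gap to which `α(q)`
  -- applies.
  have Tm : Measurable[futureAt X (s + 2 * j * q - q + q)] T :=
    (measurable_sum_comp hf.measurable fun i hi => measurable_futureAt X (by
      have := (Finset.mem_Ioc.1 hi).1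
      omega)).const_mul _
  have Em : Measurable[futureAt X (s + 2 * j * q - q + q)] E :=
    (Real.measurable_exp.comp Tm).sub_const 1
  have Eb : ∀ ω, |E ω| ≤ 2 * |T ω| := fun ω => Real.abs_exp_sub_one_le (Tb ω)
  have Ti : Integrable T P :=
    Integrable.of_bound (Tm.mono (futureAt_le hX _) le_rfl).aestronglyMeasurable 1 (ae_of_all _ Tb)
  have Ei : Integrable E P :=
    Integrable.of_bound (Em.mono (futureAt_le hX _) le_rfl).aestronglyMeasurable 2
      (ae_of_all _ fun ω => (Eb ω).trans (by linarith [Tb ω]))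
  rw [mixMin, mul_min_of_nonneg _ _ (by norm_num : (0 : ℝ) ≤ 8)]
  -- The bound by `α(q)` is the mixing inequality with `M = 2`. The bound by `h` ignores mixing:
  -- both the conditional and the plain mean are at most `E|exp T - 1| ≤ 2 E|T| ≤ 4h`.
  refine le_min ?_ ?_
  · have := integral_abs_condExp_sub_le (P := P) (pastAt_le hX (s + 2 * j * q - q))
      (futureAt_le hX _) (fun A B hA hB => hs.abs_sub_le_alpha hX (k := q) hA hB) Em (M := 2)
      (fun ω => (Eb ω).trans (by linarith [Tb ω]))
    linarith
  · have h1 : ∫ ω, |T ω| ∂P ≤ 2 * h := by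
      calc ∫ ω, |T ω| ∂P ≤ ∫ ω, (q : ℝ)⁻¹ * ∑ i ∈ block s q j, |f (X i ω)| ∂P := by
            refine integral_mono Ti.abs ((integrable_finsetSum _ fun i _ =>
              (hf.integrable_comp hX i).abs).const_mul _) fun ω => ?_
            simp only [hT]
            rw [abs_mul, abs_of_pos (inv_pos.2 hq0)]
            gcongr
            exact Finset.abs_sum_le_sum_abs _ _
        _ = (q : ℝ)⁻¹ * ∑ i ∈ block s q j, ∫ ω, |f (X i ω)| ∂P := by
            rw [integral_const_mul, integral_finsetSum _ fun i _ => (hf.integrable_comp hX i).abs]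
        _ ≤ (q : ℝ)⁻¹ * ∑ i ∈ block s q j, (2 * h) := by
            gcongr with i
            exact (hf.integral_abs_le i).trans (by gcongr; exact min_le_right _ _)
        _ = 2 * h := by
            rw [Finset.sum_const, card_block, nsmul_eq_mul]
            field_simp
    have h2 : ∫ ω, |E ω| ∂P ≤ 4 * h := by
      calc ∫ ω, |E ω| ∂P ≤ ∫ ω, 2 * |T ω| ∂P := integral_mono Ei.abs (Ti.abs.const_mul 2) Eb
        _ ≤ _ := by rw [integral_const_mul]; linarith
    set m := pastAt X (s + 2 * j * q - q)
    calc ∫ ω, |(P[E | m]) ω - ∫ ω', E ω' ∂P| ∂P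
        ≤ ∫ ω, (|(P[E | m]) ω| + |∫ ω', E ω' ∂P|) ∂P :=
          integral_mono (integrable_condExp.sub (integrable_const _)).abs
            (integrable_condExp.abs.add (integrable_const _)) fun ω => abs_sub _ _
      _ = ∫ ω, |(P[E | m]) ω| ∂P + |∫ ω', E ω' ∂P| := by
          rw [integral_add integrable_condExp.abs (integrable_const _)]
          simp
      _ ≤ ∫ ω, |E ω| ∂P + ∫ ω, |E ω| ∂P :=
          add_le_add (integral_abs_condExp_le _) abs_integral_le_integral_abs
      _ ≤ 8 * h := by linarith

/-- Since `exp T - 1 ≤ T + T²` for `|T| ≤ 1` and `T` is centred, only the variance of the block sum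
remains, at most `2q ∑ (α(k) ∧ h)`, divided by `q²`. -/
lemma MomentBounds.integral_exp_block_le (hf : MomentBounds X P h f)
    (hX : ∀ i, Measurable (X i)) (hh : 0 ≤ h) (hsum : Summable (mixMin X P h))
    {q : ℕ} (hq : 1 ≤ q) (s : ℤ) (j : ℕ) :
    ∫ ω, (Real.exp ((q : ℝ)⁻¹ * ∑ i ∈ block s q j, f (X i ω)) - 1) ∂P ≤
      (q : ℝ)⁻¹ * (2 * ∑' k, mixMin X P h k) := by
  have hq0 : (0 : ℝ) < q := by exact_mod_cast hq
  set S : Ω → ℝ := fun ω => ∑ i ∈ block s q j, f (X i ω) with hS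
  have Sb : ∀ ω, |S ω| ≤ q := fun ω =>
    (hf.abs_sum_le _ ω).trans_eq (by rw [card_block])
  have Sm : Measurable S := measurable_sum_comp hf.measurable fun i _ => hX i
  have Si : Integrable S P := Integrable.of_bound Sm.aestronglyMeasurable q (ae_of_all _ Sb)
  have S2i : Integrable (fun ω => S ω ^ 2) P :=
    Integrable.of_bound (Sm.pow_const 2).aestronglyMeasurable ((q : ℝ) ^ 2) (ae_of_all _ fun ω => by
      rw [norm_pow]
      exact pow_le_pow_left₀ (norm_nonneg _) (Sb ω) 2)
  have Tb : ∀ ω, |(q : ℝ)⁻¹ * S ω| ≤ 1 := fun ω => by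
    rw [abs_mul, abs_of_pos (inv_pos.2 hq0), inv_mul_le_one₀ hq0]
    exact Sb ω
  have Ei : Integrable (fun ω => Real.exp ((q : ℝ)⁻¹ * S ω) - 1) P :=
    Integrable.of_bound ((Real.measurable_exp.comp (Sm.const_mul _)).sub_const 1).aestronglyMeasurable
      2 (ae_of_all _ fun ω => (Real.abs_exp_sub_one_le (Tb ω)).trans (by linarith [Tb ω]))
  calc ∫ ω, (Real.exp ((q : ℝ)⁻¹ * S ω) - 1) ∂P
      ≤ ∫ ω, ((q : ℝ)⁻¹ * S ω + ((q : ℝ)⁻¹) ^ 2 * S ω ^ 2) ∂P := by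
        refine integral_mono Ei ((Si.const_mul _).add (S2i.const_mul _)) fun ω => ?_
        have := (le_abs_self _).trans (Real.abs_exp_sub_one_sub_id_le (Tb ω))
        simp only [← mul_pow]
        linarith
    _ = (q : ℝ)⁻¹ * ∫ ω, S ω ∂P + ((q : ℝ)⁻¹) ^ 2 * ∫ ω, S ω ^ 2 ∂P := by
        rw [integral_add (Si.const_mul _) (S2i.const_mul _), integral_const_mul,
          integral_const_mul]
    _ = ((q : ℝ)⁻¹) ^ 2 * ∫ ω, S ω ^ 2 ∂P := by
        rw [integral_finsetSum _ fun i _ => hf.integrable_comp hX i]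
        simp [hf.integral_eq_zero]
    _ ≤ ((q : ℝ)⁻¹) ^ 2 * (q * (2 * ∑' k, mixMin X P h k)) := by
        gcongr
        have := hf.integral_sum_sq_le hX hh hsum (block s q j)
        rwa [card_block] at this
    _ = _ := by field_simp

/-- The maximum of the partial sums of separated block sums. -/
theorem MomentBounds.exists_remainder_block (hf : MomentBounds X P h f)
    (hs : StrictlyStationary X P) (hX : ∀ i, Measurable (X i)) (hh : 0 ≤ h)
    (hsum : Summable (mixMin X P h)) {q : ℕ} (hq : 1 ≤ q) (s : ℤ) (N : ℕ) {p : ℝ} (hp : 0 ≤ p) :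
    ∃ R : Ω → ℝ≥0∞, Measurable R ∧
      (∀ k ≤ N, ∀ ω, ENNReal.ofReal (∑ j ∈ Finset.range k, ∑ i ∈ block s q j, f (X i ω)) ≤
        ENNReal.ofReal (q * p + N * (2 * ∑' k, mixMin X P h k)) + R ω) ∧
      ∫⁻ ω, R ω ∂P ≤ ENNReal.ofReal (q * Real.exp (-p) + 8 * (N * q * mixMin X P h q)) := by
  have hq0 : (0 : ℝ) < q := by exact_mod_cast hq
  set v := ∑' k, mixMin X P h k with hv
  have hv0 : 0 ≤ v := tsum_nonneg (mixMin_nonneg hh)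
  -- The past up to the end of block `j - 1`: it contains all previous blocks and lies a full gap
  -- `q` before block `j`.
  set G : ℕ → MeasurableSpace Ω := fun j => pastAt X (s + 2 * j * q - q) with hG
  have Gm : Monotone G := fun a b hab => pastAt_mono X (by
    have : (a : ℤ) * q ≤ b * q := by gcongr
    linarith)
  have Gle : ∀ j, G j ≤ ‹MeasurableSpace Ω› := fun j => pastAt_le hX _
  set U : ℕ → Ω → ℝ := fun j ω => (q : ℝ)⁻¹ * ∑ i ∈ block s q j, f (X i ω) with hU
  have Um : ∀ j, Measurable[G (j + 1)] (U j) := fun j =>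
    (measurable_sum_comp hf.measurable fun i hi => measurable_pastAt X (by
      have := (Finset.mem_Ioc.1 hi).2
      push_cast
      linarith)).const_mul _
  have Ub : ∀ j ω, |U j ω| ≤ 1 := fun j ω => by
    rw [hU, abs_mul, abs_of_pos (inv_pos.2 hq0), inv_mul_le_one₀ hq0]
    exact (hf.abs_sum_le _ ω).trans_eq (by rw [card_block])
  set c : ℕ → ℝ := fun j => ∫ ω, (Real.exp (U j ω) - 1) ∂P with hc
  have hcle : ∀ j, c j ≤ (q : ℝ)⁻¹ * (2 * v) := fun j =>
    hf.integral_exp_block_le hX hh hsum hq s j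
  set D : ℕ → Ω → ℝ := fun j ω => |expComp P G U j ω - c j| with hD
  have Ds : ∀ j, Measurable (D j) := fun j => by
    have : StronglyMeasurable (expComp P G U j) := stronglyMeasurable_condExp.mono (Gle j)
    exact (this.measurable.sub_const _).abs
  have Di : ∀ j, Integrable (D j) P := fun j =>
    (integrable_condExp.sub (integrable_const _)).abs
  have Dle : ∀ j, ∫ ω, D j ω ∂P ≤ 8 * mixMin X P h q := fun j =>
    hf.integral_abs_condExp_block_le hs hX hq s j
  set M : Ω → ℝ := fun ω => runMax p (fun i => compSum P G U i ω) N with hM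
  have Mm : Measurable M :=
    ((stronglyMeasurable_runMax_compSum (P := P) Gm Um p N).mono (Gle N)).measurable
  have Mi : Integrable M P := integrable_runMax_compSum Gle Um Ub p N
  have Mp : ∀ ω, p ≤ M ω := fun ω => level_le_runMax _ _ _
  have Mle : ∫ ω, M ω ∂P ≤ p + Real.exp (-p) := integral_runMax_compSum_le Gm Gle Um Ub hp N
  -- The remainder collects the overshoot of the running maximum above `p`, of mean at most
  -- `exp(-p)`, and the fluctuations of the compensators. The level `p` and the compensator means
  -- form the deterministic part.
  set r : Ω → ℝ := fun ω => q * ((M ω - p) + ∑ j ∈ Finset.range N, D j ω) with hr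
  have DSi : Integrable (fun ω => ∑ j ∈ Finset.range N, D j ω) P :=
    integrable_finsetSum _ fun j _ => Di j
  have Mpi : Integrable (fun ω => M ω - p) P := Mi.sub (integrable_const p)
  have ri : Integrable r P := (Mpi.add DSi).const_mul _
  have r0 : ∀ ω, 0 ≤ r ω := fun ω =>
    mul_nonneg hq0.le (add_nonneg (sub_nonneg.2 (Mp ω))
      (Finset.sum_nonneg fun j _ => abs_nonneg _))
  refine ⟨fun ω => ENNReal.ofReal (r ω), ?_, ?_, ?_⟩
  · have : Measurable r := by
      refine ((Mm.sub_const p).add ?_).const_mul _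
      exact Finset.measurable_fun_sum _ fun j _ => Ds j
    exact this.ennreal_ofReal
  · intro k hk ω
    rw [← ENNReal.ofReal_add (by positivity) (r0 ω)]
    refine ENNReal.ofReal_le_ofReal ?_
    have e1 : ∑ j ∈ Finset.range k, ∑ i ∈ block s q j, f (X i ω) =
        q * ∑ j ∈ Finset.range k, U j ω := by
      simp only [hU, ← Finset.mul_sum]
      field_simp
    have e2 : ∑ j ∈ Finset.range k, U j ω =
        compSum P G U k ω + ∑ j ∈ Finset.range k, expComp P G U j ω := by
      rw [compSum, Finset.sum_sub_distrib]
      ring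
    have e3 : compSum P G U k ω ≤ M ω :=
      (le_runMax_self (z := fun i => compSum P G U i ω) (by simpa [compSum] using hp) k).trans
        (monotone_runMax _ _ hk)
    have e4 : ∑ j ∈ Finset.range k, expComp P G U j ω ≤
        ∑ j ∈ Finset.range N, D j ω + N * ((q : ℝ)⁻¹ * (2 * v)) := by
      calc ∑ j ∈ Finset.range k, expComp P G U j ω
          ≤ ∑ j ∈ Finset.range k, (D j ω + (q : ℝ)⁻¹ * (2 * v)) :=
            Finset.sum_le_sum fun j _ => by
              have := le_abs_self (expComp P G U j ω - c j)
              have h2 := hcle j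
              simp only [hD]
              linarith
        _ ≤ ∑ j ∈ Finset.range N, (D j ω + (q : ℝ)⁻¹ * (2 * v)) :=
            Finset.sum_le_sum_of_subset_of_nonneg (Finset.range_subset_range.2 hk)
              fun j _ _ => by positivity
        _ = _ := by rw [Finset.sum_add_distrib, Finset.sum_const, Finset.card_range, nsmul_eq_mul]
    rw [e1, e2]
    calc (q : ℝ) * (compSum P G U k ω + ∑ j ∈ Finset.range k, expComp P G U j ω)
        ≤ q * (M ω + (∑ j ∈ Finset.range N, D j ω + N * ((q : ℝ)⁻¹ * (2 * v)))) := by gcongr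
      _ = q * p + N * (2 * v) + r ω := by
          simp only [hr]
          field_simp
          ring
  · rw [← ofReal_integral_eq_lintegral_ofReal ri (ae_of_all _ r0)]
    refine ENNReal.ofReal_le_ofReal ?_
    calc ∫ ω, r ω ∂P
        = q * ((∫ ω, M ω ∂P - p) + ∑ j ∈ Finset.range N, ∫ ω, D j ω ∂P) := by
          rw [integral_const_mul, integral_add Mpi DSi, integral_sub Mi (integrable_const p),
            integral_finsetSum _ fun j _ => Di j]
          simp
      _ ≤ q * (Real.exp (-p) + ∑ j ∈ Finset.range N, 8 * mixMin X P h q) := by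
          gcongr with j
          · linarith
          · exact Dle j
      _ = _ := by
          rw [Finset.sum_const, Finset.card_range, nsmul_eq_mul]
          ring

end MixingLIL

/-! ### From blocks to partial sums, and the choice of block length. -/

namespace MixingLIL

lemma sum_Ioc_int_split (a : ℤ → ℝ) {l m r : ℤ} (h1 : l ≤ m) (h2 : m ≤ r) :
    ∑ i ∈ Finset.Ioc l r, a i = ∑ i ∈ Finset.Ioc l m, a i + ∑ i ∈ Finset.Ioc m r, a i := by
  rw [← Finset.Ioc_union_Ioc_eq_Ioc h1 h2, Finset.sum_union]
  rw [Finset.disjoint_left]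
  intro i hi hi'
  exact absurd (Finset.mem_Ioc.1 hi).2 (not_le.2 (Finset.mem_Ioc.1 hi').1)

lemma sum_Icc_nat_eq_sum_Ioc_int (a : ℤ → ℝ) (k : ℕ) :
    ∑ i ∈ Finset.Icc 1 k, a (i : ℤ) = ∑ i ∈ Finset.Ioc (0 : ℤ) k, a i := by
  refine Finset.sum_nbij (fun n : ℕ => (n : ℤ)) ?_ ?_ ?_ fun _ _ => rfl
  · intro i hi
    simp only [Finset.mem_Icc, Finset.mem_Ioc] at *
    omega
  · intro i _ j _ hij
    exact Int.ofNat_injective hij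
  · intro i hi
    simp only [Finset.coe_Ioc, Set.mem_Ioc] at hi
    refine ⟨i.toNat, ?_, ?_⟩
    · simp only [Finset.coe_Icc, Set.mem_Icc]
      omega
    · simp only
      omega

/-- Splitting a sum over `K` consecutive blocks into the blocks of even and of odd rank. -/
lemma sum_Ioc_eq_sum_blocks (a : ℤ → ℝ) (q K : ℕ) :
    ∑ i ∈ Finset.Ioc (0 : ℤ) (K * q), a i =
      ∑ j ∈ Finset.range ((K + 1) / 2), ∑ i ∈ block 0 q j, a i +
        ∑ j ∈ Finset.range (K / 2), ∑ i ∈ block q q j, a i := by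
  induction K with
  | zero => simp
  | succ K ih =>
    have hq : (0 : ℤ) ≤ q := by positivity
    rw [sum_Ioc_int_split a (m := K * q) (by positivity) (by push_cast; nlinarith), ih]
    rcases Nat.even_or_odd' K with ⟨c, rfl | rfl⟩
    · rw [show (2 * c + 1) / 2 = c by omega, show (2 * c + 1 + 1) / 2 = c + 1 by omega,
        show 2 * c / 2 = c by omega, Finset.sum_range_succ (fun j => ∑ i ∈ block 0 q j, a i)]
      have : Finset.Ioc (((2 * c : ℕ) : ℤ) * q) (((2 * c + 1 : ℕ) : ℤ) * q) = block 0 q c := by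
        unfold block; congr 1 <;> push_cast <;> ring
      rw [this]
      ring
    · rw [show (2 * c + 1 + 1) / 2 = c + 1 by omega, show (2 * c + 1 + 1 + 1) / 2 = c + 1 by omega,
        show (2 * c + 1) / 2 = c by omega, Finset.sum_range_succ (fun j => ∑ i ∈ block q q j, a i)]
      have : Finset.Ioc (((2 * c + 1 : ℕ) : ℤ) * q) (((2 * c + 1 + 1 : ℕ) : ℤ) * q) =
          block q q c := by
        unfold block; congr 1 <;> push_cast <;> ring
      rw [this]
      ring

variable {Ω : Type u} [MeasurableSpace Ω] {X : ℤ → Ω → ℝ} {P : Measure Ω}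
  {h : ℝ} {f : ℝ → ℝ}

/-- The incomplete last block has fewer than `q` terms, each at most `1`. -/
lemma MomentBounds.sum_le_blocks (hf : MomentBounds X P h f) {q : ℕ} (hq : 1 ≤ q) (k : ℕ) (ω : Ω) :
    ∑ i ∈ Finset.Icc 1 k, f (X (i : ℤ) ω) ≤ q +
      (∑ j ∈ Finset.range ((k / q + 1) / 2), ∑ i ∈ block 0 q j, f (X i ω) +
        ∑ j ∈ Finset.range (k / q / 2), ∑ i ∈ block q q j, f (X i ω)) := by
  have h1 : k / q * q ≤ k := Nat.div_mul_le_self k q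
  have h2 : k < k / q * q + q := by
    have := Nat.lt_div_mul_add (a := k) hq
    simpa using this
  rw [sum_Icc_nat_eq_sum_Ioc_int (fun i => f (X i ω)),
    sum_Ioc_int_split _ (m := ((k / q : ℕ) : ℤ) * q) (by positivity) (by exact_mod_cast h1),
    sum_Ioc_eq_sum_blocks, add_comm]
  gcongr
  refine (le_abs_self _).trans ((hf.abs_sum_le _ ω).trans ?_)
  rw [Int.card_Ioc]
  norm_cast
  omega

variable [IsProbabilityMeasure P]

lemma MomentBounds.exists_remainder_sum (hf : MomentBounds X P h f)
    (hs : StrictlyStationary X P) (hX : ∀ i, Measurable (X i)) (hh : 0 ≤ h)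
    (hsum : Summable (mixMin X P h)) {q : ℕ} (hq : 1 ≤ q) (n : ℕ) {p : ℝ} (hp : 0 ≤ p) :
    ∃ R : Ω → ℝ≥0∞, Measurable R ∧
      (∀ k ≤ n, ∀ ω, ENNReal.ofReal (∑ i ∈ Finset.Icc 1 k, f (X (i : ℤ) ω)) ≤
        ENNReal.ofReal (q + 2 * (q * p + (n / q : ℕ) * (2 * ∑' k, mixMin X P h k))) + R ω) ∧
      ∫⁻ ω, R ω ∂P ≤ ENNReal.ofReal (2 * (q * Real.exp (-p) + 8 * (n * mixMin X P h q))) := by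
  obtain ⟨R₁, hm₁, hk₁, hi₁⟩ := hf.exists_remainder_block hs hX hh hsum hq 0 (n / q) hp
  obtain ⟨R₂, hm₂, hk₂, hi₂⟩ := hf.exists_remainder_block hs hX hh hsum hq q (n / q) hp
  have hv0 : 0 ≤ ∑' k, mixMin X P h k := tsum_nonneg (mixMin_nonneg hh)
  have hg := mixMin_nonneg (X := X) (P := P) hh q
  refine ⟨fun ω => R₁ ω + R₂ ω, hm₁.add hm₂, fun k hk ω => ?_, ?_⟩
  · have hd : k / q ≤ n / q := Nat.div_le_div_right hk
    have hd₁ : (k / q + 1) / 2 ≤ n / q := le_trans (by generalize k / q = K; omega) hd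
    have hd₂ : k / q / 2 ≤ n / q := (Nat.div_le_self _ _).trans hd
    set C := (q : ℝ) * p + (n / q : ℕ) * (2 * ∑' k, mixMin X P h k)
    have hC : 0 ≤ C := by positivity
    calc _ ≤ ENNReal.ofReal (q +
          (∑ j ∈ Finset.range ((k / q + 1) / 2), ∑ i ∈ block 0 q j, f (X i ω) +
          ∑ j ∈ Finset.range (k / q / 2), ∑ i ∈ block q q j, f (X i ω))) :=
          ENNReal.ofReal_le_ofReal (hf.sum_le_blocks hq k ω)
      _ ≤ ENNReal.ofReal q + ((ENNReal.ofReal C + R₁ ω) + (ENNReal.ofReal C + R₂ ω)) := by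
          exact ENNReal.ofReal_add_le.trans (add_le_add le_rfl
            (ENNReal.ofReal_add_le.trans (add_le_add (hk₁ _ hd₁ ω) (hk₂ _ hd₂ ω))))
      _ = _ := by
          rw [two_mul, ENNReal.ofReal_add (p := q) (q := C + C) (by positivity) (by positivity),
            ENNReal.ofReal_add (p := C) hC hC]
          ring
  · rw [lintegral_add_left hm₁]
    refine (add_le_add hi₁ hi₂).trans ?_
    rw [← ENNReal.ofReal_add (by positivity) (by positivity), ← two_mul]
    refine ENNReal.ofReal_le_ofReal ?_
    have : ((n / q : ℕ) : ℝ) * q ≤ n := by exact_mod_cast Nat.div_mul_le_self n q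
    gcongr

/-- The maximum of the partial sums exceeds its typical size by a remainder of small mean. -/
theorem MomentBounds.exists_remainder_abs_sum (hf : MomentBounds X P h f)
    (hs : StrictlyStationary X P) (hX : ∀ i, Measurable (X i)) (hh : 0 ≤ h)
    (hsum : Summable (mixMin X P h)) {σ : ℝ} (hσ0 : 0 ≤ σ) (hσ : σ ^ 2 = ∑' k, mixMin X P h k)
    {x : ℝ} (hx : 0 < x) (n : ℕ) {p : ℝ} (hp : 0 ≤ p) :
    ∃ R : Ω → ℝ≥0∞, Measurable R ∧
      (∀ k ≤ n, ∀ ω, ENNReal.ofReal |∑ i ∈ Finset.Icc 1 k, f (X (i : ℤ) ω)| ≤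
        ENNReal.ofReal (σ * (x + 2 * (x * p) + 8 * (n / x))) + R ω) ∧
      ∫⁻ ω, R ω ∂P ≤ ENNReal.ofReal (4 * (σ * x * Real.exp (-p)) +
        32 * (n * mixMin X P h ⌊σ * x⌋₊)) := by
  have hσx : 0 ≤ σ * x := by positivity
  have hg := fun k => mixMin_nonneg (X := X) (P := P) hh k
  -- If `σ x < 1` no block fits. The remainder is then the whole sum of absolute values, of mean at
  -- most `2n (α(0) ∧ h)`, which the claimed bound covers because its coefficient is taken at `⌊σ x⌋
  -- = 0`.
  rcases Nat.eq_zero_or_pos ⌊σ * x⌋₊ with hq | hq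
  · rw [hq]
    refine ⟨fun ω => ∑ i ∈ Finset.Icc 1 n, ENNReal.ofReal |f (X (i : ℤ) ω)|, ?_, ?_, ?_⟩
    · exact Finset.measurable_fun_sum _ fun i _ =>
        ((hf.measurable.comp (hX i)).abs).ennreal_ofReal
    · intro k hk ω
      refine le_add_left ?_
      simp only
      rw [← ENNReal.ofReal_sum_of_nonneg fun i _ => abs_nonneg _]
      refine ENNReal.ofReal_le_ofReal ((Finset.abs_sum_le_sum_abs _ _).trans ?_)
      exact Finset.sum_le_sum_of_subset_of_nonneg (Finset.Icc_subset_Icc_right hk)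
        fun _ _ _ => abs_nonneg _
    · have hm : ∀ i ∈ Finset.Icc 1 n, Measurable fun ω => ENNReal.ofReal |f (X (i : ℤ) ω)| :=
        fun i _ => ((hf.measurable.comp (hX i)).abs).ennreal_ofReal
      simp only
      rw [lintegral_finsetSum _ hm]
      calc _ ≤ ∑ i ∈ Finset.Icc 1 n, ENNReal.ofReal (2 * mixMin X P h 0) := by
            refine Finset.sum_le_sum fun i _ => ?_
            rw [← ofReal_integral_eq_lintegral_ofReal (hf.integrable_comp hX i).abs
              (ae_of_all _ fun _ => abs_nonneg _)]
            exact ENNReal.ofReal_le_ofReal (hf.integral_abs_le i)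
        _ = ENNReal.ofReal (n * (2 * mixMin X P h 0)) := by
            rw [Finset.sum_const, Nat.card_Icc, nsmul_eq_mul, Nat.add_sub_cancel,
              ENNReal.ofReal_mul (p := (n : ℝ)) (by positivity), ENNReal.ofReal_natCast]
        _ ≤ _ := by
            refine ENNReal.ofReal_le_ofReal ?_
            have h1 : 0 ≤ (n : ℝ) * mixMin X P h 0 := mul_nonneg (by positivity) (hg 0)
            have h2 : 0 ≤ σ * x * Real.exp (-p) := by positivity
            linarith
  · set q := ⌊σ * x⌋₊ with hqdef
    have hq0 : (0 : ℝ) < q := by exact_mod_cast hq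
    have hqle : (q : ℝ) ≤ σ * x := Nat.floor_le hσx
    have hqge : σ * x ≤ 2 * q := by
      have h1 : σ * x < q + 1 := Nat.lt_floor_add_one _
      have h2 : (1 : ℝ) ≤ q := by exact_mod_cast hq
      linarith
    obtain ⟨R₁, hm₁, hk₁, hi₁⟩ := hf.exists_remainder_sum hs hX hh hsum hq n hp
    obtain ⟨R₂, hm₂, hk₂, hi₂⟩ := hf.neg.exists_remainder_sum hs hX hh hsum hq n hp
    have hC : q + 2 * (q * p + (n / q : ℕ) * (2 * ∑' k, mixMin X P h k)) ≤
        σ * (x + 2 * (x * p) + 8 * (n / x)) := by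
      -- One factor `σ` is absorbed by `σ x ≤ 2q`, so the total variance term becomes linear in `σ`,
      -- like the others.
      have h1 : ((n / q : ℕ) : ℝ) * (2 * σ ^ 2) ≤ 4 * (σ * (n / x)) := by
        calc ((n / q : ℕ) : ℝ) * (2 * σ ^ 2) ≤ n / q * (2 * σ ^ 2) := by
              gcongr; exact Nat.cast_div_le
          _ = (n / x * 2 * σ / q) * (σ * x) := by field_simp
          _ ≤ (n / x * 2 * σ / q) * (2 * q) := by gcongr
          _ = 4 * (σ * (n / x)) := by field_simp; ring
      rw [← hσ]
      have h2 : q * p ≤ σ * x * p := by gcongr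
      linarith
    refine ⟨fun ω => R₁ ω + R₂ ω, hm₁.add hm₂, fun k hk ω => ?_, ?_⟩
    · refine le_trans ?_ (add_le_add (ENNReal.ofReal_le_ofReal hC) le_rfl)
      rcases abs_cases (∑ i ∈ Finset.Icc 1 k, f (X (i : ℤ) ω)) with ⟨e, -⟩ | ⟨e, -⟩
      · rw [e]
        exact (hk₁ k hk ω).trans (add_le_add le_rfl le_self_add)
      · rw [e, ← Finset.sum_neg_distrib]
        exact (hk₂ k hk ω).trans (add_le_add le_rfl le_add_self)
    · rw [lintegral_add_left hm₁]
      refine (add_le_add hi₁ hi₂).trans ?_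
      have := hg q
      rw [← ENNReal.ofReal_add (by positivity) (by positivity)]
      refine ENNReal.ofReal_le_ofReal ?_
      have h2 : q * Real.exp (-p) ≤ σ * x * Real.exp (-p) := by gcongr
      linarith

end MixingLIL

/-! ### The scale `√(n / log log n)` and summation over `n`. -/

namespace MixingLIL

/-- `log log n`. -/
noncomputable def logLog (n : ℕ) : ℝ := Real.log (Real.log (n : ℝ))

/-- The scale `√(n / log log n)` of the block lengths. -/
noncomputable def blockScale (n : ℕ) : ℝ := Real.sqrt (n / logLog n)

/-- The threshold `16` is the least integer above `e^e`, from which `log log n ≥ 1`. -/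
lemma exp_one_le_log {n : ℕ} (hn : 16 ≤ n) : Real.exp 1 ≤ Real.log n := by
  have h1 : Real.log 16 = 4 * Real.log 2 := by
    rw [show (16 : ℝ) = 2 ^ 4 by norm_num, Real.log_pow]
    norm_num
  have h2 : Real.log 16 ≤ Real.log n := Real.log_le_log (by norm_num) (by exact_mod_cast hn)
  linarith [Real.log_two_gt_d9, Real.exp_one_lt_d9]

lemma two_le_log {n : ℕ} (hn : 16 ≤ n) : 2 ≤ Real.log n := by
  linarith [exp_one_le_log hn, Real.exp_one_gt_d9]

lemma one_le_logLog {n : ℕ} (hn : 16 ≤ n) : 1 ≤ logLog n :=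
  (Real.le_log_iff_exp_le (by linarith [two_le_log hn])).2 (exp_one_le_log hn)

lemma log_succ_sub_log_le {n : ℕ} (hn : 1 ≤ n) : Real.log (n + 1 : ℕ) - Real.log n ≤ (n : ℝ)⁻¹ := by
  have hn0 : (0 : ℝ) < n := by exact_mod_cast hn
  rw [← Real.log_div (by positivity) hn0.ne']
  refine (Real.log_le_sub_one_of_pos (by positivity)).trans_eq ?_
  push_cast
  field_simp
  ring

lemma le_log_succ_sub_log {n : ℕ} (hn : 1 ≤ n) :
    ((n + 1 : ℕ) : ℝ)⁻¹ ≤ Real.log (n + 1 : ℕ) - Real.log n := by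
  have hn0 : (0 : ℝ) < n := by exact_mod_cast hn
  have h := Real.log_le_sub_one_of_pos (x := n / (n + 1 : ℕ)) (by positivity)
  rw [Real.log_div hn0.ne' (by positivity)] at h
  have e : (n : ℝ) / (n + 1 : ℕ) - 1 = -((n + 1 : ℕ) : ℝ)⁻¹ := by
    push_cast
    field_simp
    ring
  linarith

/-- The increment of `log log` is at most `1/(n log n)`, so over one step the change of the
denominator costs at most half of the gain from the numerator. -/
lemma div_logLog_sub_ge {n : ℕ} (hn : 16 ≤ n) :
    1 / (2 * logLog (n + 1)) ≤ ((n + 1 : ℕ) : ℝ) / logLog (n + 1) - n / logLog n := by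
  have hn0 : (0 : ℝ) < n := by exact_mod_cast (by omega : 0 < n)
  have hl := two_le_log hn
  have hl' := two_le_log (n := n + 1) (by omega)
  have hL := one_le_logLog hn
  have hL' := one_le_logLog (n := n + 1) (by omega)
  have h1 : logLog (n + 1) - logLog n ≤ (n : ℝ)⁻¹ * (Real.log n)⁻¹ := by
    unfold logLog
    rw [← Real.log_div (by positivity) (by positivity)]
    refine (Real.log_le_sub_one_of_pos (by positivity)).trans ?_
    rw [div_sub_one (by positivity), div_eq_mul_inv]
    gcongr
    exact log_succ_sub_log_le (by omega)
  have h2 : n * logLog (n + 1) ≤ n * logLog n + (Real.log n)⁻¹ := by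
    have := mul_le_mul_of_nonneg_left h1 hn0.le
    rw [mul_sub, mul_inv_cancel_left₀ hn0.ne'] at this
    linarith
  have h3 : (Real.log n)⁻¹ ≤ 1 / 2 := by
    rw [one_div]
    exact inv_anti₀ (by norm_num) hl
  rw [div_sub_div _ _ (by positivity) (by positivity), div_le_div_iff₀ (by positivity)
    (by positivity)]
  push_cast
  have h4 : logLog n ≤ 2 * ((n + 1) * logLog n - logLog (n + 1) * n) := by linarith
  nlinarith

/-- From `√b - √a ≥ (b - a)/(2√b)`. It lets the weights `1/√(n log log n)` be replaced by increments
of the scale. -/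
lemma blockScale_succ_sub_ge {n : ℕ} (hn : 16 ≤ n) :
    1 / (4 * Real.sqrt ((n + 1 : ℕ) * logLog (n + 1))) ≤ blockScale (n + 1) - blockScale n := by
  have hL := one_le_logLog hn
  have hL' := one_le_logLog (n := n + 1) (by omega)
  have h := div_logLog_sub_ge hn
  set a := (n : ℝ) / logLog n with ha
  set b := ((n + 1 : ℕ) : ℝ) / logLog (n + 1) with hb
  have a0 : 0 ≤ a := by positivity
  have b0 : 0 < b := by positivity
  have hab : a ≤ b := by
    have : 0 ≤ 1 / (2 * logLog (n + 1)) := by positivity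
    linarith
  have e : Real.sqrt ((n + 1 : ℕ) * logLog (n + 1)) = logLog (n + 1) * Real.sqrt b := by
    rw [show ((n + 1 : ℕ) : ℝ) * logLog (n + 1) = logLog (n + 1) ^ 2 * b by rw [hb]; field_simp,
      Real.sqrt_mul (by positivity), Real.sqrt_sq (by positivity)]
  have sb : 0 < Real.sqrt b := Real.sqrt_pos.2 b0
  have sab : Real.sqrt a ≤ Real.sqrt b := Real.sqrt_le_sqrt hab
  have sa : 0 ≤ Real.sqrt a := Real.sqrt_nonneg a
  have e2 : b - a = (Real.sqrt b - Real.sqrt a) * (Real.sqrt b + Real.sqrt a) := by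
    nlinarith [Real.sq_sqrt a0, Real.sq_sqrt b0.le]
  rw [e]
  change _ ≤ Real.sqrt b - Real.sqrt a
  have h5 : 1 / (2 * logLog (n + 1)) ≤ (Real.sqrt b - Real.sqrt a) * (2 * Real.sqrt b) := by
    refine h.trans (e2.le.trans ?_)
    gcongr
    · linarith
  calc 1 / (4 * (logLog (n + 1) * Real.sqrt b))
      = 1 / (2 * logLog (n + 1)) / (2 * Real.sqrt b) := by field_simp; norm_num
    _ ≤ _ := (div_le_iff₀ (by positivity)).2 h5

/-- The terms are dominated by the telescoping differences of `1 / log`. -/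
lemma summable_inv_mul_log_sq :
    Summable fun m : ℕ => (((m + 17 : ℕ) : ℝ) * Real.log (m + 17 : ℕ) ^ 2)⁻¹ := by
  refine summable_of_sum_range_le (c := (Real.log (16 : ℕ))⁻¹) (fun m => by positivity) fun n => ?_
  have key : ∀ m : ℕ, (((m + 17 : ℕ) : ℝ) * Real.log (m + 17 : ℕ) ^ 2)⁻¹ ≤
      (Real.log (m + 16 : ℕ))⁻¹ - (Real.log (m + 1 + 16 : ℕ))⁻¹ := by
    intro m
    have h1 := two_le_log (n := m + 16) (by omega)
    have h2 := two_le_log (n := m + 16 + 1) (by omega)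
    have h3 := le_log_succ_sub_log (n := m + 16) (by omega)
    rw [show m + 1 + 16 = m + 16 + 1 by omega, show m + 17 = m + 16 + 1 by omega]
    have h4 : Real.log (m + 16 : ℕ) ≤ Real.log (m + 16 + 1 : ℕ) :=
      Real.log_le_log (by positivity) (by push_cast; linarith)
    set u := Real.log (m + 16 : ℕ)
    set v := Real.log (m + 16 + 1 : ℕ)
    rw [inv_sub_inv (by positivity) (by positivity), mul_inv, ← div_eq_mul_inv]
    have : 0 ≤ v - u := by linarith
    apply div_le_div₀ this h3 (by positivity)
    nlinarith
  calc _ ≤ ∑ m ∈ Finset.range n,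
        ((Real.log (m + 16 : ℕ))⁻¹ - (Real.log (m + 1 + 16 : ℕ))⁻¹) :=
        Finset.sum_le_sum fun m _ => key m
    _ = (Real.log (0 + 16 : ℕ))⁻¹ - (Real.log (n + 16 : ℕ))⁻¹ :=
        Finset.sum_range_sub' (fun m : ℕ => (Real.log (m + 16 : ℕ))⁻¹) n
    _ ≤ _ := by
        have := two_le_log (n := n + 16) (by omega)
        simp only [Nat.zero_add, sub_le_self_iff]
        positivity

/-- The floor equals `k` on an interval of length `1/σ`. -/
lemma lintegral_floor_le {g : ℕ → ℝ} {σ : ℝ} (hσ : 0 < σ) :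
    ∫⁻ y in Set.Ioi (0 : ℝ), ENNReal.ofReal (g ⌊σ * y⌋₊) ≤
      ENNReal.ofReal σ⁻¹ * ∑' k, ENNReal.ofReal (g k) := by
  have hfl : Measurable fun y : ℝ => ⌊σ * y⌋₊ := (measurable_id.const_mul σ).nat_floor
  set A : ℕ → Set ℝ := fun k => {y | ⌊σ * y⌋₊ = k} with hA
  have Am : ∀ k, MeasurableSet (A k) := fun k => hfl (measurableSet_singleton k)
  have e : ∀ y : ℝ, ENNReal.ofReal (g ⌊σ * y⌋₊) =
      ∑' k, (A k).indicator (fun _ => ENNReal.ofReal (g k)) y := by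
    intro y
    rw [tsum_eq_single ⌊σ * y⌋₊]
    · rw [Set.indicator_of_mem]
      rfl
    · intro k hk
      rw [Set.indicator_of_notMem]
      exact fun h => hk h.symm
  simp_rw [e]
  rw [lintegral_tsum fun k => (measurable_const.indicator (Am k)).aemeasurable,
    ← ENNReal.tsum_mul_left]
  refine ENNReal.tsum_le_tsum fun k => ?_
  rw [lintegral_indicator_const (Am k), mul_comm, Measure.restrict_apply (Am k)]
  gcongr
  calc volume (A k ∩ Set.Ioi 0) ≤ volume (Set.Icc (k / σ) ((k + 1) / σ)) := by
        refine measure_mono fun y hy => ?_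
        have h1 : ⌊σ * y⌋₊ = k := hy.1
        have h0 : (0 : ℝ) < y := hy.2
        have h2 := (Nat.floor_eq_iff (by positivity)).1 h1
        refine ⟨?_, ?_⟩
        · rw [div_le_iff₀ hσ]; linarith
        · rw [le_div_iff₀ hσ]; linarith
    _ = _ := by
        rw [Real.volume_Icc]
        congr 1
        field_simp
        ring

/-- A lower Riemann sum: `g` is antitone and is evaluated at the right endpoint of each interval. -/
lemma tsum_increment_mul_le {g : ℕ → ℝ} (hg : Antitone g) {σ : ℝ} (hσ : 0 < σ)
    {x : ℕ → ℝ} (hx : Monotone x) (hx0 : 0 ≤ x 0) :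
    ∑' n, ENNReal.ofReal (x (n + 1) - x n) * ENNReal.ofReal (g ⌊σ * x (n + 1)⌋₊) ≤
      ENNReal.ofReal σ⁻¹ * ∑' k, ENNReal.ofReal (g k) := by
  refine le_trans ?_ (lintegral_floor_le hσ)
  have hd : Pairwise (Function.onFun Disjoint fun n => Set.Ioc (x n) (x (n + 1))) :=
    hx.pairwise_disjoint_on_Ioc_succ
  calc _ ≤ ∑' n, ∫⁻ y in Set.Ioc (x n) (x (n + 1)), ENNReal.ofReal (g ⌊σ * y⌋₊) := by
        refine ENNReal.tsum_le_tsum fun n => ?_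
        rw [← Real.volume_Ioc, mul_comm, ← setLIntegral_const]
        refine setLIntegral_mono' measurableSet_Ioc fun y hy => ENNReal.ofReal_le_ofReal (hg ?_)
        gcongr
        exact hy.2
    _ = ∫⁻ y in ⋃ n, Set.Ioc (x n) (x (n + 1)), ENNReal.ofReal (g ⌊σ * y⌋₊) :=
        (lintegral_iUnion (fun n => measurableSet_Ioc) hd _).symm
    _ ≤ _ := by
        refine lintegral_mono_set (Set.iUnion_subset fun n y hy => ?_)
        exact (hx0.trans (hx (Nat.zero_le n))).trans_lt hy.1

lemma tsum_inv_sqrt_mul_le {g : ℕ → ℝ} (hg : Antitone g) {σ : ℝ} (hσ : 0 < σ) :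
    ∑' m : ℕ, ENNReal.ofReal ((Real.sqrt ((m + 17 : ℕ) * logLog (m + 17)))⁻¹) *
        ENNReal.ofReal (g ⌊σ * blockScale (m + 17)⌋₊) ≤
      4 * (ENNReal.ofReal σ⁻¹ * ∑' k, ENNReal.ofReal (g k)) := by
  have step := fun m : ℕ => blockScale_succ_sub_ge (n := m + 16) (by omega)
  have mono : Monotone fun m : ℕ => blockScale (m + 16) := by
    refine monotone_nat_of_le_succ fun m => ?_
    have h := step m
    have : 0 ≤ 1 / (4 * Real.sqrt ((m + 16 + 1 : ℕ) * logLog (m + 16 + 1))) := by positivity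
    rw [show m + 1 + 16 = m + 16 + 1 by omega]
    linarith
  refine le_trans ?_ (mul_le_mul_right (tsum_increment_mul_le hg hσ mono (Real.sqrt_nonneg _)) 4)
  rw [← ENNReal.tsum_mul_left]
  refine ENNReal.tsum_le_tsum fun m => ?_
  rw [show m + 1 + 16 = m + 17 by omega, ← mul_assoc]
  gcongr
  rw [show (4 : ℝ≥0∞) = ENNReal.ofReal 4 by simp, ← ENNReal.ofReal_mul (by norm_num)]
  refine ENNReal.ofReal_le_ofReal ?_
  have h := step m
  rw [show m + 16 + 1 = m + 17 by omega] at h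
  calc (Real.sqrt ((m + 17 : ℕ) * logLog (m + 17)))⁻¹
      = 4 * (1 / (4 * Real.sqrt ((m + 17 : ℕ) * logLog (m + 17)))) := by
        rw [one_div, mul_inv]; ring
    _ ≤ _ := by gcongr

lemma blockScale_eq {n : ℕ} (hn : 16 ≤ n) :
    blockScale n * logLog n = Real.sqrt (n * logLog n) ∧
      n / blockScale n = Real.sqrt (n * logLog n) ∧ 0 < blockScale n := by
  have hL := one_le_logLog hn
  have hn0 : (0 : ℝ) < n := by exact_mod_cast (by omega : 0 < n)
  have hx : 0 < blockScale n := Real.sqrt_pos.2 (by positivity)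
  have e1 : blockScale n * logLog n = Real.sqrt (n * logLog n) := by
    rw [show (n : ℝ) * logLog n = n / logLog n * logLog n ^ 2 by field_simp,
      Real.sqrt_mul (by positivity), Real.sqrt_sq (by positivity)]
    rfl
  refine ⟨e1, ?_, hx⟩
  rw [← e1, div_eq_iff hx.ne']
  have : blockScale n * blockScale n = n / logLog n := Real.mul_self_sqrt (by positivity)
  calc (n : ℝ) = n / logLog n * logLog n := by field_simp
    _ = _ := by rw [← this]; ring

end MixingLIL

/-! ### The deviation at a fixed level. -/

namespace MixingLIL

variable {Ω : Type u} [MeasurableSpace Ω] {X : ℤ → Ω → ℝ} {P : Measure Ω}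

/-- The standard deviation proxy `√(∑_k α(k) ∧ h)`. -/
noncomputable def sdev (X : ℤ → Ω → ℝ) (P : Measure Ω) (h : ℝ) : ℝ≥0∞ :=
  (∑' k, ENNReal.ofReal (mixMin X P h k)) ^ (1 / 2 : ℝ)

lemma summable_mixMin [IsProbabilityMeasure P] {h : ℝ} (hh : 0 ≤ h) (hs : sdev X P h ≠ ∞) :
    Summable (mixMin X P h) := by
  have h1 : ∑' k, ENNReal.ofReal (mixMin X P h k) ≠ ∞ := by
    intro h2
    apply hs
    rw [sdev, h2]
    exact ENNReal.top_rpow_of_pos (by norm_num)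
  have h3 := ENNReal.summable_toReal h1
  refine h3.congr fun k => ?_
  exact ENNReal.toReal_ofReal (mixMin_nonneg hh k)

lemma sdev_toReal_sq [IsProbabilityMeasure P] {h : ℝ} (hh : 0 ≤ h) (hs : sdev X P h ≠ ∞) :
    (sdev X P h).toReal ^ 2 = ∑' k, mixMin X P h k := by
  have h1 := summable_mixMin hh hs
  have h0 : 0 ≤ ∑' k, mixMin X P h k := tsum_nonneg (mixMin_nonneg hh)
  rw [sdev, ← ENNReal.ofReal_tsum_of_nonneg (mixMin_nonneg hh) h1, ← ENNReal.toReal_rpow,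
    ENNReal.toReal_ofReal h0, ← Real.sqrt_eq_rpow, Real.sq_sqrt h0]

/-- The weighted remainders are summable, with a sum controlled by the standard deviation. -/
lemma tsum_remainder_le [IsProbabilityMeasure P] {h : ℝ} (hh : 0 ≤ h) (hs : sdev X P h ≠ ∞) :
    ∑' m : ℕ, ENNReal.ofReal ((((m + 17 : ℕ) : ℝ) *
        Real.sqrt ((m + 17 : ℕ) * logLog (m + 17)))⁻¹) *
      ENNReal.ofReal (4 * ((sdev X P h).toReal * blockScale (m + 17) *
          Real.exp (-(2 * logLog (m + 17)))) +
        32 * ((m + 17 : ℕ) * mixMin X P h ⌊(sdev X P h).toReal * blockScale (m + 17)⌋₊)) ≤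
    ENNReal.ofReal (4 * ∑' m : ℕ, (((m + 17 : ℕ) : ℝ) * Real.log (m + 17 : ℕ) ^ 2)⁻¹ + 128) *
      sdev X P h := by
  set σ := (sdev X P h).toReal with hσdef
  have hσ0 : 0 ≤ σ := ENNReal.toReal_nonneg
  have hσ2 := sdev_toReal_sq hh hs
  have hsum := summable_mixMin hh hs
  have hg := fun k => mixMin_nonneg (X := X) (P := P) hh k
  rw [← ENNReal.ofReal_toReal hs, ← hσdef]
  set S₀ := ∑' m : ℕ, (((m + 17 : ℕ) : ℝ) * Real.log (m + 17 : ℕ) ^ 2)⁻¹ with hS₀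
  have hS₀0 : 0 ≤ S₀ := tsum_nonneg fun m => by positivity
  have term : ∀ m : ℕ, ENNReal.ofReal ((((m + 17 : ℕ) : ℝ) *
        Real.sqrt ((m + 17 : ℕ) * logLog (m + 17)))⁻¹) *
      ENNReal.ofReal (4 * (σ * blockScale (m + 17) * Real.exp (-(2 * logLog (m + 17)))) +
        32 * ((m + 17 : ℕ) * mixMin X P h ⌊σ * blockScale (m + 17)⌋₊)) ≤
      ENNReal.ofReal (4 * σ * (((m + 17 : ℕ) : ℝ) * Real.log (m + 17 : ℕ) ^ 2)⁻¹) +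
        32 * (ENNReal.ofReal ((Real.sqrt ((m + 17 : ℕ) * logLog (m + 17)))⁻¹) *
          ENNReal.ofReal (mixMin X P h ⌊σ * blockScale (m + 17)⌋₊)) := by
    intro m
    obtain ⟨e1, -, e3⟩ := blockScale_eq (n := m + 17) (by omega)
    have hL := one_le_logLog (n := m + 17) (by omega)
    have hl := two_le_log (n := m + 17) (by omega)
    have hN : (0 : ℝ) < (m + 17 : ℕ) := by positivity
    -- This motivates `p = 2 log log n`: the weighted overshoot becomes a multiple of `1/(n log²
    -- n)`.
    have hexp : Real.exp (-(2 * logLog (m + 17))) = (Real.log (m + 17 : ℕ) ^ 2)⁻¹ := by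
      rw [Real.exp_neg, two_mul, Real.exp_add, logLog, Real.exp_log (by positivity), sq]
    have := hg ⌊σ * blockScale (m + 17)⌋₊
    rw [hexp, ← e1, show (32 : ℝ≥0∞) = ENNReal.ofReal 32 by simp,
      ← ENNReal.ofReal_mul (by positivity), ← ENNReal.ofReal_mul (by positivity),
      ← ENNReal.ofReal_mul (by positivity), ← ENNReal.ofReal_add (by positivity) (by positivity)]
    refine ENNReal.ofReal_le_ofReal ?_
    have h1 : (logLog (m + 17))⁻¹ ≤ 1 := inv_le_one_of_one_le₀ hL
    calc _ = 4 * σ * (((m + 17 : ℕ) : ℝ) * Real.log (m + 17 : ℕ) ^ 2)⁻¹ * (logLog (m + 17))⁻¹ +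
          32 * ((blockScale (m + 17) * logLog (m + 17))⁻¹ *
            mixMin X P h ⌊σ * blockScale (m + 17)⌋₊) := by
          field_simp
      _ ≤ 4 * σ * (((m + 17 : ℕ) : ℝ) * Real.log (m + 17 : ℕ) ^ 2)⁻¹ * 1 +
          32 * ((blockScale (m + 17) * logLog (m + 17))⁻¹ *
            mixMin X P h ⌊σ * blockScale (m + 17)⌋₊) := by gcongr
      _ = _ := by rw [mul_one]
  refine (ENNReal.tsum_le_tsum term).trans ?_
  rw [ENNReal.tsum_add, ENNReal.tsum_mul_left]
  have first : ∑' m : ℕ, ENNReal.ofReal (4 * σ *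
      (((m + 17 : ℕ) : ℝ) * Real.log (m + 17 : ℕ) ^ 2)⁻¹) = ENNReal.ofReal (4 * σ * S₀) := by
    rw [hS₀, ← tsum_mul_left, ENNReal.ofReal_tsum_of_nonneg (fun m => by positivity)
      (summable_inv_mul_log_sq.mul_left _)]
  have second : ∑' m : ℕ, ENNReal.ofReal ((Real.sqrt ((m + 17 : ℕ) * logLog (m + 17)))⁻¹) *
      ENNReal.ofReal (mixMin X P h ⌊σ * blockScale (m + 17)⌋₊) ≤ 4 * ENNReal.ofReal σ := by
    rcases hσ0.eq_or_lt with h0 | hpos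
    -- When `σ = 0` every floor is `0`, and the coefficient at lag `0` vanishes.
    · have hz : mixMin X P h 0 ≤ 0 := by
        have := hsum.le_tsum 0 fun k _ => hg k
        rw [← hσ2, ← hσdef, ← h0] at this
        simpa using this
      simp [← h0, ENNReal.ofReal_eq_zero.2 hz]
    -- The Riemann sum yields `σ⁻¹ σ² = σ`: the block length was taken proportional to `σ` for this
    -- cancellation.
    · refine (tsum_inv_sqrt_mul_le (antitone_mixMin h) hpos).trans_eq ?_
      rw [← ENNReal.ofReal_tsum_of_nonneg hg hsum, ← hσ2, ← ENNReal.ofReal_mul (by positivity), sq,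
        ← hσdef, inv_mul_cancel_left₀ hpos.ne']
  rw [first, ← ENNReal.ofReal_mul (by positivity)]
  calc _ ≤ ENNReal.ofReal (4 * σ * S₀) + 32 * (4 * ENNReal.ofReal σ) := by gcongr
    _ = _ := by
      rw [show (32 : ℝ≥0∞) = ENNReal.ofReal 32 by simp,
        show (4 : ℝ≥0∞) = ENNReal.ofReal 4 by simp, ← ENNReal.ofReal_mul (by norm_num),
        ← ENNReal.ofReal_mul (by norm_num), ← ENNReal.ofReal_add (by positivity) (by positivity)]
      congr 1
      ring

section Level

variable [IsProbabilityMeasure P]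

/-- Centred indicators of complementary events are opposite. For `t > 0` it is the upper tail whose
probability is controlled by `H`. -/
lemma abs_indicatorSum_Iic (hX : Measurable (X 0)) (t : ℝ) (k : ℕ) (ω : Ω) :
    |indicatorSum X P (Set.Iic t) k ω| = |indicatorSum X P (Set.Ioi t) k ω| := by
  rw [← abs_neg, indicatorSum, indicatorSum, ← Finset.sum_neg_distrib]
  congr 1
  refine Finset.sum_congr rfl fun i _ => ?_
  have h1 : P.real {ω | X 0 ω ∈ Set.Iic t} = 1 - P.real {ω | X 0 ω ∈ Set.Ioi t} := by
    refine Eq.trans ?_ (probReal_compl_eq_one_sub (hX measurableSet_Ioi))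
    congr 1
    ext ω
    simp
  rw [h1]
  rcases le_or_gt (X i ω) t with h | h
  · simp [h, not_lt.2 h]
  · simp [h, not_le.2 h]

/-- `tail` uses a strict inequality, so atoms have to be excluded; they are countably many and do
not affect the integral over `t`. -/
lemma measureReal_Iic_le_tail {t : ℝ} (ht : t ≤ 0) (h0 : P {ω | X 0 ω = t} = 0) :
    P.real {ω | X 0 ω ∈ Set.Iic t} ≤ tail X P |t| := by
  have h1 : {ω | X 0 ω ∈ Set.Iic t} ⊆ {ω | |t| < |X 0 ω|} ∪ {ω | X 0 ω = t} := by
    intro ω hω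
    rcases (show X 0 ω ≤ t from hω).lt_or_eq with h | h
    · left
      change |t| < |X 0 ω|
      rw [abs_of_nonpos ht, abs_of_neg (h.trans_le ht)]
      linarith
    · exact Or.inr h
  refine (measureReal_mono h1).trans ((measureReal_union_le _ _).trans_eq ?_)
  rw [measureReal_def P {ω | X 0 ω = t}, h0, ENNReal.toReal_zero, add_zero]
  rfl

lemma measureReal_Ioi_le_tail {t : ℝ} (ht : 0 < t) :
    P.real {ω | X 0 ω ∈ Set.Ioi t} ≤ tail X P |t| := by
  refine measureReal_mono fun ω hω => ?_
  have h : t < X 0 ω := hω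
  change |t| < |X 0 ω|
  rw [abs_of_pos ht]
  exact h.trans_le (le_abs_self _)

/-- `max_{1 ≤ k ≤ n} |∑_{i ≤ k} (1_{X_i ≤ t} - F(t))|`. -/
noncomputable def maxDev (X : ℤ → Ω → ℝ) (P : Measure Ω) (n : ℕ) (t : ℝ) (ω : Ω) : ℝ≥0∞ :=
  ⨆ k ∈ Finset.Icc 1 n, ENNReal.ofReal |indicatorSum X P (Set.Iic t) k ω|

/-- The mean excess of the deviation at a fixed level. -/
theorem lintegral_maxDev_sub_le (hs : StrictlyStationary X P) (hX : ∀ i, Measurable (X i))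
    {n : ℕ} (hn : 16 ≤ n) {t : ℝ} (h0 : P {ω | X 0 ω = t} = 0)
    (hsd : sdev X P (tail X P |t|) ≠ ∞) :
    ∫⁻ ω, (maxDev X P n t ω -
        ENNReal.ofReal (13 * Real.sqrt (n * logLog n)) * sdev X P (tail X P |t|)) ∂P ≤
      ENNReal.ofReal (4 * ((sdev X P (tail X P |t|)).toReal * blockScale n *
          Real.exp (-(2 * logLog n))) +
        32 * (n * mixMin X P (tail X P |t|)
          ⌊(sdev X P (tail X P |t|)).toReal * blockScale n⌋₊)) := by
  have hh : 0 ≤ tail X P |t| := measureReal_nonneg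
  set h := tail X P |t|
  obtain ⟨S, hSm, hSle, hSeq⟩ : ∃ S : Set ℝ, MeasurableSet S ∧ P.real {ω | X 0 ω ∈ S} ≤ h ∧
      ∀ k ω, |indicatorSum X P (Set.Iic t) k ω| = |indicatorSum X P S k ω| := by
    rcases le_or_gt t 0 with ht | ht
    · exact ⟨Set.Iic t, measurableSet_Iic, measureReal_Iic_le_tail ht h0, fun _ _ => rfl⟩
    · exact ⟨Set.Ioi t, measurableSet_Ioi, measureReal_Ioi_le_tail ht,
        abs_indicatorSum_Iic (hX 0) t⟩
  obtain ⟨e1, e2, e3⟩ := blockScale_eq hn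
  have hL := one_le_logLog hn
  have hσ0 : 0 ≤ (sdev X P h).toReal := ENNReal.toReal_nonneg
  obtain ⟨R, -, hk, hR⟩ := (momentBounds_indicator hs hX hSm hSle).exists_remainder_abs_sum hs hX
    hh (summable_mixMin hh hsd) hσ0 (sdev_toReal_sq hh hsd) e3 n
    (p := 2 * logLog n) (by positivity)
  refine (lintegral_mono fun ω => ?_).trans hR
  rw [tsub_le_iff_left]
  refine iSup₂_le fun k hkn => ?_
  rw [hSeq]
  refine (hk k (Finset.mem_Icc.1 hkn).2 ω).trans (add_le_add ?_ le_rfl)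
  nth_rewrite 2 [← ENNReal.ofReal_toReal hsd]
  rw [← ENNReal.ofReal_mul (by positivity), mul_comm _ (sdev X P h).toReal]
  refine ENNReal.ofReal_le_ofReal (mul_le_mul_of_nonneg_left ?_ hσ0)
  -- With `r = √(n log log n)` one has `x log log n = n/x = r`, so the bracket is `x + 4r + 8r ≤
  -- 13r`.
  have h1 : blockScale n ≤ Real.sqrt (n * logLog n) := by
    rw [← e1]
    exact le_mul_of_one_le_right e3.le hL
  rw [e2]
  nlinarith

end Level

end MixingLIL

/-! ### Integration over levels and conclusion. -/

namespace MixingLIL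

variable {Ω : Type u} [MeasurableSpace Ω] {X : ℤ → Ω → ℝ} {P : Measure Ω}

lemma lintegral_comp_abs_eq {F : ℝ → ℝ≥0∞} :
    ∫⁻ t, F |t| = 2 * ∫⁻ t in Set.Ioi 0, F t := by
  have h1 : ∫⁻ t in Set.Ioi 0, F |t| = ∫⁻ t in Set.Ioi 0, F t :=
    setLIntegral_congr_fun measurableSet_Ioi fun t (ht : 0 < t) => by
      simp only [abs_of_pos ht]
  have h2 : ∫⁻ t in Set.Iio 0, F |t| = ∫⁻ t in Set.Ioi 0, F |t| := by
    have := (Measure.measurePreserving_neg (volume : Measure ℝ)).setLIntegral_comp_preimage_emb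
      (MeasurableEquiv.neg ℝ).measurableEmbedding (fun t => F |t|) (Set.Ioi 0)
    rw [← this]
    simp
  rw [← lintegral_add_compl _ (measurableSet_Ioi (a := (0 : ℝ))), Set.compl_Ioi,
    setLIntegral_congr Iio_ae_eq_Iic.symm, h2, h1, two_mul]

lemma V_eq_lintegral_sdev (X : ℤ → Ω → ℝ) (P : Measure Ω) :
    V X P = ∫⁻ t in Set.Ioi (0 : ℝ), sdev X P (tail X P t) := rfl

variable [IsProbabilityMeasure P]

lemma antitone_tail : Antitone (tail X P) := fun _ _ hst =>
  measureReal_mono fun _ hω => lt_of_le_of_lt hst hω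

lemma measurable_sdev_tail_abs : Measurable fun t : ℝ => sdev X P (tail X P |t|) := by
  have h1 : Measurable fun t : ℝ => tail X P |t| := antitone_tail.measurable.comp measurable_norm
  exact (Measurable.tsum fun k => (measurable_const.min h1).ennreal_ofReal).pow_const _

lemma measurable_indicatorSum_Iic (hX : ∀ i, Measurable (X i)) (k : ℕ) :
    Measurable fun z : ℝ × Ω => indicatorSum X P (Set.Iic z.1) k z.2 := by
  unfold indicatorSum
  refine Finset.measurable_fun_sum _ fun i _ => Measurable.sub ?_ ?_
  · have hS : MeasurableSet {z : ℝ × Ω | X i z.2 ≤ z.1} :=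
      measurableSet_le ((hX i).comp measurable_snd) measurable_fst
    exact measurable_one.indicator hS
  · have : Monotone fun t : ℝ => P.real {ω | X 0 ω ∈ Set.Iic t} := fun a b hab =>
      measureReal_mono fun ω (hω : X 0 ω ≤ a) => hω.trans hab
    exact this.measurable.comp measurable_fst

lemma measurable_maxDev (hX : ∀ i, Measurable (X i)) (n : ℕ) :
    Measurable fun z : ℝ × Ω => maxDev X P n z.1 z.2 := by
  unfold maxDev
  exact Measurable.iSup fun k => Measurable.iSup fun _ =>
    (measurable_indicatorSum_Iic hX k).abs.ennreal_ofReal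

lemma maxW1_le_lintegral_maxDev (hX : Measurable (X 0)) (n : ℕ) (ω : Ω) :
    maxW1 X P n ω ≤ ∫⁻ t, maxDev X P n t ω :=
  iSup₂_le fun k hk => (mul_W1_empirical_le X P hX (Finset.mem_Icc.1 hk).1 ω).trans
    (lintegral_mono fun t => le_iSup₂ (f := fun k (_ : k ∈ Finset.Icc 1 n) =>
      ENNReal.ofReal |indicatorSum X P (Set.Iic t) k ω|) k hk)

/-- The excess of the deviation over its typical size at the level `t`. -/
noncomputable def excess (X : ℤ → Ω → ℝ) (P : Measure Ω) (n : ℕ) (t : ℝ) (ω : Ω) : ℝ≥0∞ :=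
  maxDev X P n t ω - ENNReal.ofReal (13 * Real.sqrt (n * logLog n)) * sdev X P (tail X P |t|)

lemma measurable_excess (hX : ∀ i, Measurable (X i)) (n : ℕ) :
    Measurable fun z : ℝ × Ω => excess X P n z.1 z.2 :=
  (measurable_maxDev hX n).sub ((measurable_sdev_tail_abs.comp measurable_fst).const_mul _)

/-- The typical sizes integrate to `13 r · 2V = 26 V r`, so exceeding `(26 V + ε) r` forces the
integrated excess to reach `ε r`. -/
lemma ofReal_mul_le_lintegral_excess (hX : ∀ i, Measurable (X i)) (hV : V X P < ∞) {ε : ℝ}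
    (hε : 0 < ε) {n : ℕ} {ω : Ω}
    (hω : ENNReal.ofReal ((26 * (V X P).toReal + ε) * Real.sqrt (n * logLog n)) <
      maxW1 X P n ω) :
    ENNReal.ofReal (ε * Real.sqrt (n * logLog n)) ≤ ∫⁻ t, excess X P n t ω := by
  set r := Real.sqrt (n * logLog n) with hr
  have hr0 : 0 ≤ r := Real.sqrt_nonneg _
  have hV0 : 0 ≤ (V X P).toReal := ENNReal.toReal_nonneg
  have h1 : ∫⁻ t, ENNReal.ofReal (13 * r) * sdev X P (tail X P |t|) =
      ENNReal.ofReal (26 * (V X P).toReal * r) := by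
    rw [lintegral_const_mul _ measurable_sdev_tail_abs,
      lintegral_comp_abs_eq (F := fun t => sdev X P (tail X P t)), ← V_eq_lintegral_sdev,
      ← ENNReal.ofReal_toReal hV.ne, show (2 : ℝ≥0∞) = ENNReal.ofReal 2 by simp,
      ← ENNReal.ofReal_mul (by positivity), ← ENNReal.ofReal_mul (by positivity),
      ENNReal.toReal_ofReal hV0]
    congr 1
    ring
  have h2 : maxW1 X P n ω ≤ ENNReal.ofReal (26 * (V X P).toReal * r) + ∫⁻ t, excess X P n t ω := by
    rw [← h1, ← lintegral_add_left (measurable_sdev_tail_abs.const_mul _)]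
    exact (maxW1_le_lintegral_maxDev (hX 0) n ω).trans (lintegral_mono fun t => le_add_tsub)
  have h3 := hω.le.trans h2
  rw [add_mul, ENNReal.ofReal_add (by positivity) (by positivity)] at h3
  exact (ENNReal.add_le_add_iff_left ENNReal.ofReal_ne_top).1 h3

lemma inv_mul_measure_le (hX : ∀ i, Measurable (X i)) (hV : V X P < ∞) {ε : ℝ}
    (hε : 0 < ε) {n : ℕ} (hn : 16 ≤ n) :
    (n : ℝ≥0∞)⁻¹ * P {ω | ENNReal.ofReal ((26 * (V X P).toReal + ε) *
        Real.sqrt (n * logLog n)) < maxW1 X P n ω} ≤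
      ENNReal.ofReal ε⁻¹ * ∫⁻ t, ENNReal.ofReal (((n : ℝ) * Real.sqrt (n * logLog n))⁻¹) *
        ∫⁻ ω, excess X P n t ω ∂P := by
  have hL := one_le_logLog hn
  have hn0 : (0 : ℝ) < n := by exact_mod_cast (by omega : 0 < n)
  have hr0 : 0 < Real.sqrt (n * logLog n) := Real.sqrt_pos.2 (by positivity)
  set r := Real.sqrt (n * logLog n)
  have hem := measurable_excess (P := P) hX n
  have hmeas : Measurable fun ω => ∫⁻ t, excess X P n t ω := hem.lintegral_prod_left'
  have h1 : P {ω | ENNReal.ofReal ((26 * (V X P).toReal + ε) * r) < maxW1 X P n ω} ≤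
      ENNReal.ofReal ((ε * r)⁻¹) * ∫⁻ t, ∫⁻ ω, excess X P n t ω ∂P := by
    rw [lintegral_lintegral_swap hem.aemeasurable, ENNReal.ofReal_inv_of_pos (by positivity)]
    -- Measurability of `maxW1` is not needed: its event lies inside an event about the integrated
    -- excess, to which Markov's inequality applies.
    refine (measure_mono fun ω hω => ofReal_mul_le_lintegral_excess hX hV hε hω).trans ?_
    refine (meas_ge_le_lintegral_div hmeas.aemeasurable ?_ ENNReal.ofReal_ne_top).trans_eq ?_
    · exact (ENNReal.ofReal_pos.2 (by positivity)).ne'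
    · rw [ENNReal.div_eq_inv_mul]
  rw [lintegral_const_mul _ hem.lintegral_prod_right', ← mul_assoc]
  refine (mul_le_mul_right h1 _).trans_eq ?_
  rw [← mul_assoc, ← ENNReal.ofReal_natCast, ← ENNReal.ofReal_inv_of_pos hn0,
    ← ENNReal.ofReal_mul (by positivity), ← ENNReal.ofReal_mul (by positivity)]
  congr 2
  field_simp

theorem tsum_inv_mul_measure_lt_top (hs : StrictlyStationary X P) (hX : ∀ i, Measurable (X i))
    (hV : V X P < ∞) {ε : ℝ} (hε : 0 < ε) :
    ∑' m : ℕ, ((m + 17 : ℕ) : ℝ≥0∞)⁻¹ * P {ω | ENNReal.ofReal ((26 * (V X P).toReal + ε) *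
        Real.sqrt ((m + 17 : ℕ) * logLog (m + 17))) < maxW1 X P (m + 17) ω} < ∞ := by
  have h2V : ∫⁻ t, sdev X P (tail X P |t|) = 2 * V X P :=
    lintegral_comp_abs_eq (F := fun t => sdev X P (tail X P t))
  have h2 : ∫⁻ t, sdev X P (tail X P |t|) ≠ ∞ := by
    rw [h2V]
    exact ENNReal.mul_ne_top (by simp) hV.ne
  have hfin : ∀ᵐ t : ℝ, sdev X P (tail X P |t|) < ∞ := ae_lt_top measurable_sdev_tail_abs h2
  have hatom : ∀ᵐ t : ℝ, P {ω | X 0 ω = t} = 0 := by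
    have hc := (Measure.countable_meas_level_set_pos (μ := P) (hX 0)).measure_zero volume
    rw [ae_iff]
    simpa [pos_iff_ne_zero] using hc
  set K := ENNReal.ofReal (4 * ∑' m : ℕ, (((m + 17 : ℕ) : ℝ) * Real.log (m + 17 : ℕ) ^ 2)⁻¹ + 128)
  calc _ ≤ ∑' m : ℕ, ENNReal.ofReal ε⁻¹ * ∫⁻ t, ENNReal.ofReal ((((m + 17 : ℕ) : ℝ) *
          Real.sqrt ((m + 17 : ℕ) * logLog (m + 17)))⁻¹) * ∫⁻ ω, excess X P (m + 17) t ω ∂P :=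
        ENNReal.tsum_le_tsum fun m => inv_mul_measure_le hX hV hε (by omega)
    _ = ENNReal.ofReal ε⁻¹ * ∫⁻ t, ∑' m : ℕ, ENNReal.ofReal ((((m + 17 : ℕ) : ℝ) *
          Real.sqrt ((m + 17 : ℕ) * logLog (m + 17)))⁻¹) * ∫⁻ ω, excess X P (m + 17) t ω ∂P := by
        rw [ENNReal.tsum_mul_left, lintegral_tsum fun m =>
          ((measurable_excess hX (m + 17)).lintegral_prod_right'.const_mul _).aemeasurable]
    _ ≤ ENNReal.ofReal ε⁻¹ * ∫⁻ t, K * sdev X P (tail X P |t|) := by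
        refine mul_le_mul_right (lintegral_mono_ae ?_) _
        filter_upwards [hfin, hatom] with t h1 h0
        refine (ENNReal.tsum_le_tsum fun m => ?_).trans
          (tsum_remainder_le (X := X) (P := P) measureReal_nonneg h1.ne)
        gcongr
        exact lintegral_maxDev_sub_le hs hX (by omega) h0 h1.ne
    _ < ∞ := by
        rw [lintegral_const_mul _ measurable_sdev_tail_abs]
        exact ENNReal.mul_lt_top ENNReal.ofReal_lt_top
          (ENNReal.mul_lt_top ENNReal.ofReal_lt_top h2.lt_top)

/-- The estimates start at `17 = 16 + 1`, the right end of the first increment beyond the threshold;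
the finitely many earlier terms are finite. -/
lemma tsum_subtype_three_le_lt_top {a : ℕ → ℝ≥0∞} (ha : ∀ n, 3 ≤ n → a n ≠ ∞)
    (hsum : ∑' m, a (m + 17) < ∞) : ∑' n : {n : ℕ // 3 ≤ n}, a n < ∞ := by
  have e : ∑' n : {n : ℕ // 3 ≤ n}, a n = ∑' n, {n : ℕ | 3 ≤ n}.indicator a n :=
    tsum_subtype {n : ℕ | 3 ≤ n} a
  rw [e, ← Summable.sum_add_tsum_nat_add' (k := 17) ENNReal.summable]
  refine ENNReal.add_lt_top.2 ⟨ENNReal.sum_lt_top.2 fun n _ => ?_, ?_⟩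
  · by_cases hn : 3 ≤ n
    · rw [Set.indicator_of_mem (show n ∈ {n : ℕ | 3 ≤ n} from hn)]
      exact (ha n hn).lt_top
    · rw [Set.indicator_of_notMem (show n ∉ {n : ℕ | 3 ≤ n} from hn)]
      exact ENNReal.zero_lt_top
  · refine lt_of_le_of_lt (ENNReal.tsum_le_tsum fun m => ?_) hsum
    exact Set.indicator_le_self _ _ _

end MixingLIL

theorem proposition1 :
    ∃ η : ℝ, 0 < η ∧
      ∀ (Ω : Type u) [MeasurableSpace Ω] (P : Measure Ω) [IsProbabilityMeasure P]
        (X : ℤ → Ω → ℝ),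
        (∀ i : ℤ, Measurable (X i)) →
        MixingLIL.StrictlyStationary X P →
        MixingLIL.V X P < ∞ →
        ∀ ε : ℝ, 0 < ε →
          ∑' n : {n : ℕ // 3 ≤ n},
            (n : ℝ≥0∞)⁻¹ *
              P {ω | ENNReal.ofReal ((η * (MixingLIL.V X P).toReal + ε) *
                    Real.sqrt ((n : ℝ) * Real.log (Real.log (n : ℝ)))) <
                  MixingLIL.maxW1 X P (n : ℕ) ω} < ∞ := by
  refine ⟨26, by norm_num, fun Ω _ P _ X hX hs hV ε hε => ?_⟩
  refine MixingLIL.tsum_subtype_three_le_lt_top (a := fun n : ℕ => (n : ℝ≥0∞)⁻¹ *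
    P {ω | ENNReal.ofReal ((26 * (MixingLIL.V X P).toReal + ε) *
      Real.sqrt ((n : ℝ) * Real.log (Real.log (n : ℝ)))) < MixingLIL.maxW1 X P n ω})
    (fun n hn => ?_) ?_
  · exact ENNReal.mul_ne_top (ENNReal.inv_ne_top.2 (by simp; omega)) (measure_ne_top _ _)
  · exact MixingLIL.tsum_inv_mul_measure_lt_top hs hX hV hε
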